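/- Let $L$ be a number field with algebraic closure $\overline{L}$, and let $E/L$ be an elliptic curve with complex multiplication, i.e. $\mathrm{End}_{\overline{L}}(E)\neq\mathbb{Z}$: some endomorphism of $E$ defined over $\overline{L}$ is not multiplication by an integer. Let $\ell$ be any prime, let $E[\ell]\subset E(\overline{L})$ be the group of $\ell$-torsion points, and let $L(E[\ell])$ be the field generated over $L$ by the coordinates of the affine points of $E[\ell]$. Let $$\rho_\ell:\mathrm{Gal}(\overline{L}/L)\to \mathrm{Aut}(E[\ell])\cong \mathrm{GL}_2(\mathbb{F}_\ell)$$ be the representation given by the action of the Galois group on the coordinates of the $\ell$-torsion points. Then the image of $\rho_\ell$ is a solvable group. Equivalently, the extension $L(E[\ell])/L$ is Galois and $\mathrm{Gal}(L(E[\ell])/L)$ is solvable. -/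

import Mathlib

open scoped WeierstrassCurve.Affine

/-- Homogeneous coordinates in `ℙ²` of a point of a plane Weierstrass cubic: the point at infinity
is `[0 : 1 : 0]` and an affine point `(x, y)` is `[x : y : 1]`. -/
def WeierstrassCurve.Affine.Point.homogeneousCoords {K : Type*} [Field K]
    {W : WeierstrassCurve.Affine K} : W.Point → Fin 3 → K
  | .zero => ![0, 1, 0]
  | .some x y _ => ![x, y, 1]

namespace EllipticCM

open WeierstrassCurve.Affine

section Morphisms

variable {K : Type*} [Field K]

/-- A map between the point sets of two Weierstrass curves over an algebraically closed field `K`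
is a morphism of projective varieties if around every point `P` it is given by a triple of
homogeneous polynomials of the same degree, not all vanishing at `P`: the triple computes the map
at every point `Q` at which its entries do not all vanish. -/
def IsMorphism {W W' : WeierstrassCurve.Affine K} (f : W.Point → W'.Point) : Prop :=
  ∀ P : W.Point, ∃ (d : ℕ) (F : Fin 3 → MvPolynomial (Fin 3) K),
    (∀ i, (F i).IsHomogeneous d) ∧
    (∃ i, MvPolynomial.eval P.homogeneousCoords (F i) ≠ 0) ∧
    ∀ Q : W.Point, (∃ i, MvPolynomial.eval Q.homogeneousCoords (F i) ≠ 0) →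
      ∃ c : Kˣ, ∀ i, MvPolynomial.eval Q.homogeneousCoords (F i) =
        c * (f Q).homogeneousCoords i

end Morphisms

variable {L : Type*} [Field L] (K : Type*) [Field K] [Algebra L K] [DecidableEq K]
  (E : WeierstrassCurve L)

/-- The set `End(E)` of endomorphisms of `E` over the algebraically closed field `K ⊇ L`: the
homomorphisms of algebraic groups from `E` to itself (the zero map is included). -/
def endomorphisms : Set (AddMonoid.End (E⁄K).Point) :=
  {φ | IsMorphism (φ : (E⁄K).Point → (E⁄K).Point)}

/-- `E` has complex multiplication if `End(E)` is larger than `ℤ`: some endomorphism of `E` over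
`K` is not the multiplication map `[m]` for any integer `m`. (Here `K` is an algebraic closure
of the base field, which has characteristic zero.) -/
def HasCM : Prop :=
  ∃ φ ∈ endomorphisms K E, ∀ m : ℤ, φ ≠ (m : AddMonoid.End (E⁄K).Point)

/-- The group `E[ℓ]` of `ℓ`-torsion points of `E` with coordinates in `K`. -/
def torsion (ℓ : ℕ) : AddSubgroup (E⁄K).Point where
  carrier := {P | ℓ • P = 0}
  zero_mem' := smul_zero ℓ
  add_mem' {P Q} hP hQ := by
    simp only [Set.mem_ofPred_eq] at hP hQ ⊢
    rw [smul_add, hP, hQ, add_zero]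
  neg_mem' {P} hP := by
    simp only [Set.mem_ofPred_eq] at hP ⊢
    rw [smul_neg, hP, neg_zero]

/-- `E[ℓ]` is killed by `ℓ`, hence a module over `ℤ/ℓℤ`. -/
noncomputable instance torsion.module (ℓ : ℕ) : Module (ZMod ℓ) (torsion K E ℓ) :=
  AddCommGroup.zmodModule fun P => Subtype.ext P.2

variable {K} in
/-- An automorphism `σ` of `K` over `L` acts on `E[ℓ]` by acting on coordinates. -/
noncomputable def galoisMap (ℓ : ℕ) (σ : K ≃ₐ[L] K) : torsion K E ℓ →+ torsion K E ℓ :=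
  ((Point.map (W' := E) (σ : K →ₐ[L] K)).comp (torsion K E ℓ).subtype).codRestrict _ fun P => by
    have hP : ℓ • (P : (E⁄K).Point) = 0 := P.2
    change ℓ • Point.map (W' := E) (σ : K →ₐ[L] K) (P : (E⁄K).Point) = 0
    rw [← map_nsmul, hP, _root_.map_zero]

/-- The mod-`ℓ` Galois representation `ρ_ℓ : Gal(K/L) → GL(E[ℓ])`, where `E[ℓ]` is regarded as a
module over `ℤ/ℓℤ`. -/
noncomputable def galoisRep (ℓ : ℕ) :
    (K ≃ₐ[L] K) →* LinearMap.GeneralLinearGroup (ZMod ℓ) (torsion K E ℓ) :=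
  MonoidHom.toHomUnits
    { toFun := fun σ => (galoisMap E ℓ σ).toZModLinearMap ℓ
      map_one' := by
        refine LinearMap.ext fun P => ?_
        obtain ⟨P, hP⟩ := P
        apply Subtype.ext
        cases P <;> rfl
      map_mul' := fun σ τ => LinearMap.ext fun P => Subtype.ext
        (Point.map_map (W' := E) (τ : K →ₐ[L] K) (σ : K →ₐ[L] K) P.1).symm }

/-- The field `L(E[ℓ])` generated over `L` by the coordinates of the affine `ℓ`-torsion points. -/
def divisionField (ℓ : ℕ) : IntermediateField L K :=
  IntermediateField.adjoin L
    {z | ∃ (x y : K) (h : (E⁄K).Nonsingular x y),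
      Point.some x y h ∈ torsion K E ℓ ∧ (z = x ∨ z = y)}

end EllipticCM

/-!
The proof works with the group of points over the algebraic closure `K` only, and replaces the
theory of isogenies by rational functions of the `x`-coordinate. Put `h = 2y + a₁x + a₃`, so that
`h²` is a cubic in `x` and `-P` has coordinates `(x, -h)`. An endomorphism given by a morphism is of
the form `(x, h) ↦ (R(x), S(x) h)` (`IsMorphism.isRational`), and its degree is defined to be the
degree of the rational function `R`. The addition formulas for `x(P + Q)` and `x(P - Q)` give
`deg (φ + ψ) + deg (φ - ψ) ≤ 2 deg φ + 2 deg ψ` (`IsRational.deg_add_add_deg_sub_le`), and counting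
a general fibre gives `#ker φ ≤ deg φ` (`IsRational.ncard_ker_le`). Hence multiplication by `n` has
degree at most `n²` and `E[n]` has at most `n²` elements (`ncard_torsion_le`).

Let `O` be the group of endomorphisms of the abstract group `E(K)` some positive multiple of which is
rational. It is saturated: an element of `O` that kills `E[n]` is `n` times an element of `O`, by
the divisibility of `E(K)` (`exists_eq_nsmul_of_torsion`). Two facts follow.

* If `#E[ℓ] = ℓ²`, some element of `O` acts on `E[ℓ]` by a non-scalar (`exists_not_scalar`).
  Otherwise every rational `φ` is congruent to an integer modulo `ℓᵏ` for all `k`, and the bound on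
  the kernel of `φ` minus that integer makes `φ` itself an integer, against complex multiplication.
* An automorphism `σ` that fixes `E[4]` commutes with `O` (`IsAlmostRational.galAct_apply_comm`).
  Conjugation by `σ` is trivial on `O` modulo `4`, and it fixes each given element of `O` after
  passing to a power of `σ`, as the finitely many coefficients involved are algebraic over the base
  field. Minkowski's lemma (`eq_of_pow_eq_of_four_dvd`) shows that it is trivial.

So the automorphisms that fix `E[4]` act on `E[ℓ]` through the commutant of a non-scalar
endomorphism of a space of dimension at most two, or on a space of dimension at most one; in both
cases they commute with each other there (`commutator_fixTorsion_four_le`). The automorphisms that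
fix `E[2]` commute on `E[4]` (`commutator_fixTorsion_two_le`), and the whole group acts on the at
most three points of order two through a solvable group. Hence a term of the derived series of
`Gal(K/L)` acts trivially on `E[ℓ]`. Neither the commutativity of the endomorphism ring nor its
structure as an order in a quadratic field is needed.
-/

namespace EllipticCM

open Polynomial Filter WeierstrassCurve.Affine
open scoped commutatorElement

/-! ### Coordinates of points -/

section Coordinates

variable {K : Type*} [Field K] {W : WeierstrassCurve.Affine K}

/-- The `x`-coordinate of a point, with the junk value `0` at the point at infinity. -/
def xCoord : W.Point → K
  | .zero => 0
  | .some x _ _ => x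

/-- The function `2y + a₁x + a₃`, which changes sign under `P ↦ -P`, with the junk value `0` at the
point at infinity. -/
def hCoord : W.Point → K
  | .zero => 0
  | .some x y _ => 2 * y + W.a₁ * x + W.a₃

@[simp] lemma xCoord_zero : xCoord (0 : W.Point) = 0 := rfl

@[simp] lemma hCoord_zero : hCoord (0 : W.Point) = 0 := rfl

@[simp] lemma xCoord_some {x y : K} (h : W.Nonsingular x y) : xCoord (.some x y h) = x := rfl

@[simp] lemma hCoord_some {x y : K} (h : W.Nonsingular x y) :
    hCoord (.some x y h) = 2 * y + W.a₁ * x + W.a₃ := rfl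

@[simp] lemma xCoord_neg (P : W.Point) : xCoord (-P) = xCoord P := by
  rcases P with _ | ⟨x, y, h⟩ <;> rfl

@[simp] lemma hCoord_neg (P : W.Point) : hCoord (-P) = -hCoord P := by
  rcases P with _ | ⟨x, y, h⟩
  · change (0 : K) = -0
    simp
  · rw [Point.neg_some, hCoord_some, hCoord_some, negY]
    ring

lemma exists_some_of_ne_zero {P : W.Point} (hP : P ≠ 0) :
    ∃ x y h, P = Point.some (W' := W) x y h := by
  rcases P with _ | ⟨x, y, h⟩
  · exact (hP rfl).elim
  · exact ⟨x, y, h, rfl⟩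

lemma hCoord_sq {P : W.Point} (hP : P ≠ 0) :
    hCoord P ^ 2 = 4 * xCoord P ^ 3 + W.b₂ * xCoord P ^ 2 + 2 * W.b₄ * xCoord P + W.b₆ := by
  obtain ⟨x, y, h, rfl⟩ := exists_some_of_ne_zero hP
  have h1 := (equation_iff ..).mp h.1
  simp only [xCoord_some, hCoord_some, WeierstrassCurve.b₂, WeierstrassCurve.b₄,
    WeierstrassCurve.b₆]
  linear_combination 4 * h1

lemma eq_or_eq_neg_of_xCoord_eq {P Q : W.Point} (hP : P ≠ 0) (hQ : Q ≠ 0)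
    (h : xCoord P = xCoord Q) : P = Q ∨ P = -Q := by
  obtain ⟨x, y, h1, rfl⟩ := exists_some_of_ne_zero hP
  obtain ⟨x', y', h2, rfl⟩ := exists_some_of_ne_zero hQ
  exact Point.X_eq_iff.mp h

lemma eq_of_xCoord_eq_of_hCoord_eq [CharZero K] {P Q : W.Point} (hP : P ≠ 0) (hQ : Q ≠ 0)
    (h : xCoord P = xCoord Q) (h' : hCoord P = hCoord Q) : P = Q := by
  obtain ⟨x, y, h1, rfl⟩ := exists_some_of_ne_zero hP
  obtain ⟨x', y', h2, rfl⟩ := exists_some_of_ne_zero hQ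
  simp only [xCoord_some, hCoord_some] at h h'
  subst h
  have : y = y' := by
    refine mul_left_cancel₀ (two_ne_zero (α := K)) ?_
    linear_combination h'
  subst this
  rfl

section Addition

variable [DecidableEq K]

lemma add_ne_zero_of_xCoord_ne {P Q : W.Point} (h : xCoord P ≠ xCoord Q) : P + Q ≠ 0 := by
  intro h0
  rw [add_eq_zero_iff_eq_neg] at h0
  exact h (by rw [h0, xCoord_neg])

lemma xCoord_add [CharZero K] {P Q : W.Point} (hP : P ≠ 0) (hQ : Q ≠ 0)
    (h : xCoord P ≠ xCoord Q) :
    xCoord (P + Q) = ((hCoord P - hCoord Q) / (xCoord P - xCoord Q)) ^ 2 / 4 - W.b₂ / 4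
      - xCoord P - xCoord Q := by
  obtain ⟨x, y, h1, rfl⟩ := exists_some_of_ne_zero hP
  obtain ⟨x', y', h2, rfl⟩ := exists_some_of_ne_zero hQ
  simp only [xCoord_some] at h
  have hs := sub_ne_zero.mpr h
  rw [Point.add_of_X_ne h]
  simp only [xCoord_some, hCoord_some, slope_of_X_ne h, addX, WeierstrassCurve.b₂]
  field_simp
  ring

lemma hCoord_add {P Q : W.Point} (hP : P ≠ 0) (hQ : Q ≠ 0)
    (h : xCoord P ≠ xCoord Q) :
    hCoord (P + Q) = (hCoord P - hCoord Q) / (xCoord P - xCoord Q) * (xCoord P - xCoord (P + Q))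
      - hCoord P := by
  obtain ⟨x, y, h1, rfl⟩ := exists_some_of_ne_zero hP
  obtain ⟨x', y', h2, rfl⟩ := exists_some_of_ne_zero hQ
  simp only [xCoord_some] at h
  have hs := sub_ne_zero.mpr h
  rw [Point.add_of_X_ne h]
  simp only [xCoord_some, hCoord_some, slope_of_X_ne h, addY, negAddY, negY]
  generalize W.addX x x' ((y - y') / (x - x')) = t
  field_simp
  ring

lemma add_self_ne_zero {P : W.Point} (h : hCoord P ≠ 0) : P + P ≠ 0 := by
  intro h0
  rw [add_eq_zero_iff_eq_neg] at h0
  rcases P with _ | ⟨x, y, h1⟩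
  · exact h rfl
  · rw [Point.neg_some, Point.some.injEq, negY] at h0
    refine h ?_
    rw [hCoord_some]
    linear_combination h0.2

lemma add_self_eq_zero_iff {P : W.Point} : P + P = 0 ↔ P = 0 ∨ hCoord P = 0 := by
  refine ⟨fun h ↦ ?_, ?_⟩
  · by_contra! h0
    exact add_self_ne_zero h0.2 h
  · rintro (rfl | h)
    · simp
    · rcases P with _ | ⟨x, y, h1⟩
      · rfl
      · refine Point.add_of_Y_eq rfl ?_
        rw [hCoord_some] at h
        rw [negY]
        linear_combination h

/-- The tangent at an affine point `P` with `P ≠ -P`, in terms of the coordinates `xCoord` and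
`hCoord`: here `t` is the slope of the tangent to the curve `y² + a₁xy + a₃y = x³ + ⋯`. -/
lemma exists_add_self_eq {P : W.Point} (h : hCoord P ≠ 0) :
    ∃ t, 2 * t + W.a₁ = (6 * xCoord P ^ 2 + W.b₂ * xCoord P + W.b₄) / hCoord P ∧
      xCoord (P + P) = W.addX (xCoord P) (xCoord P) t ∧
      hCoord (P + P) = (2 * t + W.a₁) * (xCoord P - xCoord (P + P)) - hCoord P := by
  rcases P with _ | ⟨x, y, h1⟩
  · exact (h rfl).elim
  simp only [hCoord_some] at h
  have hn : y ≠ W.negY x y := by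
    intro h0
    rw [negY] at h0
    exact h (by linear_combination h0)
  have he : y - W.negY x y = 2 * y + W.a₁ * x + W.a₃ := by rw [negY]; ring
  rw [Point.add_self_of_Y_ne hn]
  refine ⟨W.slope x x y y, ?_, rfl, ?_⟩
  · simp only [xCoord_some, hCoord_some, slope_of_Y_ne rfl hn, WeierstrassCurve.b₂,
      WeierstrassCurve.b₄, he]
    rw [eq_div_iff h, add_mul, mul_assoc, div_mul_cancel₀ _ h]
    ring
  · simp only [xCoord_some, hCoord_some, addY, negAddY, negY]
    ring

lemma xCoord_add_self [CharZero K] {P : W.Point} (h : hCoord P ≠ 0) :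
    xCoord (P + P) = ((6 * xCoord P ^ 2 + W.b₂ * xCoord P + W.b₄) / hCoord P) ^ 2 / 4 - W.b₂ / 4
      - 2 * xCoord P := by
  obtain ⟨t, h1, h2, -⟩ := exists_add_self_eq h
  rw [← h1, h2, addX, WeierstrassCurve.b₂]
  ring

lemma hCoord_add_self {P : W.Point} (h : hCoord P ≠ 0) :
    hCoord (P + P) = (6 * xCoord P ^ 2 + W.b₂ * xCoord P + W.b₄) / hCoord P
      * (xCoord P - xCoord (P + P)) - hCoord P := by
  obtain ⟨t, h1, -, h2⟩ := exists_add_self_eq h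
  rw [← h1, h2]

lemma xCoord_add_add_xCoord_sub [CharZero K] {P Q : W.Point} (hP : P ≠ 0) (hQ : Q ≠ 0)
    (h : xCoord P ≠ xCoord Q) :
    (xCoord (P + Q) + xCoord (P - Q)) * (xCoord P - xCoord Q) ^ 2 =
      2 * xCoord P * xCoord Q * (xCoord P + xCoord Q) + W.b₂ * (xCoord P * xCoord Q)
        + W.b₄ * (xCoord P + xCoord Q) + W.b₆ := by
  have hs := sub_ne_zero.mpr h
  rw [sub_eq_add_neg P Q, xCoord_add hP hQ h, xCoord_add hP (neg_ne_zero.mpr hQ) (by simpa)]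
  simp only [xCoord_neg, hCoord_neg]
  have e1 := hCoord_sq hP
  have e2 := hCoord_sq hQ
  generalize xCoord P = x at *
  generalize xCoord Q = x' at *
  field_simp
  linear_combination 2 * e1 + 2 * e2

lemma xCoord_add_mul_xCoord_sub [CharZero K] {P Q : W.Point} (hP : P ≠ 0) (hQ : Q ≠ 0)
    (h : xCoord P ≠ xCoord Q) :
    xCoord (P + Q) * xCoord (P - Q) * (xCoord P - xCoord Q) ^ 2 =
      (xCoord P * xCoord Q) ^ 2 - W.b₄ * (xCoord P * xCoord Q)
        - W.b₆ * (xCoord P + xCoord Q) - W.b₈ := by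
  have hs := sub_ne_zero.mpr h
  rw [sub_eq_add_neg P Q, xCoord_add hP hQ h, xCoord_add hP (neg_ne_zero.mpr hQ) (by simpa)]
  simp only [xCoord_neg, hCoord_neg]
  have e1 := hCoord_sq hP
  have e2 := hCoord_sq hQ
  have e3 := W.b_relation
  generalize xCoord P = x at *
  generalize xCoord Q = x' at *
  have key : (((hCoord P - hCoord Q) / (x - x')) ^ 2 / 4 - W.b₂ / 4 - x - x') *
      (((hCoord P - -hCoord Q) / (x - x')) ^ 2 / 4 - W.b₂ / 4 - x - x') * (x - x') ^ 2 =
      ((hCoord P ^ 2 - hCoord Q ^ 2) ^ 2 / (x - x') ^ 2 - 2 * (hCoord P ^ 2 + hCoord Q ^ 2) *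
        (W.b₂ + 4 * x + 4 * x') + (W.b₂ + 4 * x + 4 * x') ^ 2 * (x - x') ^ 2) / 16 := by
    field_simp
    ring
  have e4 : hCoord P ^ 2 - hCoord Q ^ 2 =
      (x - x') * (4 * (x ^ 2 + x * x' + x' ^ 2) + W.b₂ * (x + x') + 2 * W.b₄) := by
    rw [e1, e2]; ring
  rw [key, e4, e1, e2, mul_pow, mul_div_cancel_left₀ _ (pow_ne_zero 2 hs)]
  field_simp
  linear_combination 4 * e3

lemma xCoord_add_self_mul [CharZero K] {P : W.Point} (h : hCoord P ≠ 0) :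
    xCoord (P + P) * (4 * xCoord P ^ 3 + W.b₂ * xCoord P ^ 2 + 2 * W.b₄ * xCoord P + W.b₆) =
      xCoord P ^ 4 - W.b₄ * xCoord P ^ 2 - 2 * W.b₆ * xCoord P - W.b₈ := by
  have hP : P ≠ 0 := by rintro rfl; exact h rfl
  have h2 := hCoord_sq hP
  have e3 := W.b_relation
  rw [← h2, xCoord_add_self h]
  generalize xCoord P = x at *
  generalize hCoord P = y at *
  field_simp
  linear_combination (-W.b₂ - 8 * x) * h2 + e3

end Addition

end Coordinates

/-! ### Rational functions of the `x`-coordinate -/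

section Generic

variable {K : Type*} [Field K] {W : WeierstrassCurve.Affine K}

lemma finite_xCoord_preimage_singleton (c : K) :
    {P : W.Point | xCoord P = c}.Finite := by
  by_cases h : ∃ P : W.Point, P ≠ 0 ∧ xCoord P = c
  · obtain ⟨P, hP, rfl⟩ := h
    refine Set.Finite.subset (Set.toFinite {0, P, -P}) fun Q hQ ↦ ?_
    by_cases hQ0 : Q = 0
    · simp [hQ0]
    · rcases eq_or_eq_neg_of_xCoord_eq hQ0 hP hQ with h | h <;> simp [h]
  · push Not at h
    refine Set.Finite.subset (Set.finite_singleton 0) fun Q hQ ↦ ?_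
    by_contra hQ0
    exact h Q hQ0 hQ

lemma tendsto_xCoord_cofinite : Tendsto (xCoord (W := W)) cofinite cofinite :=
  Tendsto.cofinite_of_finite_preimage_singleton fun c ↦ finite_xCoord_preimage_singleton c

lemma eventually_eval_xCoord_ne_zero {p : K[X]} (hp : p ≠ 0) :
    ∀ᶠ P : W.Point in cofinite, p.eval (xCoord P) ≠ 0 := by
  refine tendsto_xCoord_cofinite.eventually (p := fun x ↦ p.eval x ≠ 0) ?_
  simpa [eventually_cofinite] using! p.finite_setOfPred_isRoot hp

lemma eventually_ne_zero : ∀ᶠ P : W.Point in cofinite, P ≠ 0 :=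
  (Set.finite_singleton 0).eventually_cofinite_notMem

variable (W) in
/-- The cubic polynomial in `x` that equals the square of `2y + a₁x + a₃` on the curve. -/
noncomputable def hSq : K[X] := C 4 * X ^ 3 + C W.b₂ * X ^ 2 + C (2 * W.b₄) * X + C W.b₆

lemma eval_hSq {P : W.Point} (hP : P ≠ 0) : (hSq W).eval (xCoord P) = hCoord P ^ 2 := by
  rw [hCoord_sq hP, hSq]
  simp

lemma natDegree_hSq [CharZero K] : (hSq W).natDegree = 3 := by
  have h4 : (4 : K) ≠ 0 := by norm_num
  rw [hSq]
  compute_degree!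

lemma hSq_ne_zero [CharZero K] : hSq W ≠ 0 := by
  intro h
  simpa [h] using natDegree_hSq (W := W)

lemma eventually_hCoord_ne_zero [CharZero K] : ∀ᶠ P : W.Point in cofinite, hCoord P ≠ 0 := by
  filter_upwards [eventually_ne_zero, eventually_eval_xCoord_ne_zero (hSq_ne_zero (W := W))]
    with P h1 h2 h3
  exact h2 (by rw [eval_hSq h1, h3, zero_pow two_ne_zero])

section Elliptic

variable [IsAlgClosed K] [W.IsElliptic]

lemma exists_xCoord_eq (c : K) : ∃ P : W.Point, P ≠ 0 ∧ xCoord P = c := by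
  obtain ⟨y, hy⟩ := IsAlgClosed.exists_root
    (X ^ 2 + C (W.a₁ * c + W.a₃) * X - C (c ^ 3 + W.a₂ * c ^ 2 + W.a₄ * c + W.a₆) : K[X]) (by
      have : (X ^ 2 + C (W.a₁ * c + W.a₃) * X - C (c ^ 3 + W.a₂ * c ^ 2 + W.a₄ * c + W.a₆) :
        K[X]).degree = 2 := by compute_degree!
      rw [this]
      decide)
  have h : W.Equation c y := by
    rw [equation_iff]
    simp only [IsRoot, eval_sub, eval_add, eval_pow, eval_X, eval_mul, eval_C] at hy
    linear_combination hy
  exact ⟨.some c y (equation_iff_nonsingular.mp h), Point.some_ne_zero _, rfl⟩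

instance : Infinite W.Point :=
  have : Infinite K := IsAlgClosed.instInfinite
  Infinite.of_surjective xCoord fun c ↦ (exists_xCoord_eq (W := W) c).imp fun _ h ↦ h.2

lemma eq_zero_of_eventually_eval_xCoord {p : K[X]}
    (h : ∀ᶠ P : W.Point in cofinite, p.eval (xCoord P) = 0) : p = 0 := by
  by_contra hp
  obtain ⟨P, h1, h2⟩ := (h.and (eventually_eval_xCoord_ne_zero hp)).exists
  exact h2 h1

end Elliptic

/-- A `K`-valued function on the points of the curve is *rational in `x`* if away from finitely
many points it is given by a quotient of two polynomials in the `x`-coordinate. -/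
def IsRat (g : W.Point → K) : Prop :=
  ∃ p q : K[X], q ≠ 0 ∧ ∀ᶠ P in cofinite, g P * q.eval (xCoord P) = p.eval (xCoord P)

namespace IsRat

variable {g g' : W.Point → K}

lemma congr (hg : IsRat g) (h : ∀ᶠ P in cofinite, g' P = g P) : IsRat g' := by
  obtain ⟨p, q, hq, hpq⟩ := hg
  exact ⟨p, q, hq, by filter_upwards [hpq, h] with P h1 h2; rw [h2, h1]⟩

lemma const (c : K) : IsRat fun _ : W.Point ↦ c :=
  ⟨C c, 1, one_ne_zero, by simp⟩

lemma eval_xCoord (p : K[X]) : IsRat fun P : W.Point ↦ p.eval (xCoord P) :=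
  ⟨p, 1, one_ne_zero, by simp⟩

lemma xCoord : IsRat (xCoord : W.Point → K) :=
  ⟨X, 1, one_ne_zero, by simp⟩

lemma add (hg : IsRat g) (hg' : IsRat g') : IsRat fun P ↦ g P + g' P := by
  obtain ⟨p, q, hq, hpq⟩ := hg
  obtain ⟨p', q', hq', hpq'⟩ := hg'
  refine ⟨p * q' + p' * q, q * q', mul_ne_zero hq hq', ?_⟩
  filter_upwards [hpq, hpq'] with P h1 h2
  simp only [eval_add, eval_mul, ← h1, ← h2]
  ring

lemma mul (hg : IsRat g) (hg' : IsRat g') : IsRat fun P ↦ g P * g' P := by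
  obtain ⟨p, q, hq, hpq⟩ := hg
  obtain ⟨p', q', hq', hpq'⟩ := hg'
  refine ⟨p * p', q * q', mul_ne_zero hq hq', ?_⟩
  filter_upwards [hpq, hpq'] with P h1 h2
  simp only [eval_mul, ← h1, ← h2]
  ring

lemma pow (hg : IsRat g) (n : ℕ) : IsRat fun P ↦ g P ^ n := by
  induction n with
  | zero => simpa using const 1
  | succ n ih => simpa only [pow_succ] using ih.mul hg

lemma neg (hg : IsRat g) : IsRat fun P ↦ -g P := by
  simpa using (const (-1)).mul hg

lemma sub (hg : IsRat g) (hg' : IsRat g') : IsRat fun P ↦ g P - g' P := by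
  simpa only [sub_eq_add_neg] using hg.add hg'.neg

lemma inv (hg : IsRat g) : IsRat fun P ↦ (g P)⁻¹ := by
  obtain ⟨p, q, hq, hpq⟩ := hg
  by_cases hp : p = 0
  · refine ⟨0, 1, one_ne_zero, ?_⟩
    filter_upwards [hpq, eventually_eval_xCoord_ne_zero hq] with P h1 h2
    have : g P = 0 := by simpa [hp, h2] using h1
    simp [this]
  · refine ⟨q, p, hp, ?_⟩
    filter_upwards [hpq, eventually_eval_xCoord_ne_zero hp] with P h1 h2
    have : g P ≠ 0 := fun h ↦ h2 (by rw [← h1, h, zero_mul])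
    rw [← h1, inv_mul_cancel_left₀ this]

lemma div (hg : IsRat g) (hg' : IsRat g') : IsRat fun P ↦ g P / g' P := by
  simpa only [div_eq_mul_inv] using hg.mul hg'.inv

/-- A rational function vanishes almost everywhere or almost nowhere. -/
lemma eventually_eq_or_ne (hg : IsRat g) (c : K) :
    (∀ᶠ P in cofinite, g P = c) ∨ ∀ᶠ P in cofinite, g P ≠ c := by
  obtain ⟨p, q, hq, hpq⟩ := hg.sub (const c)
  by_cases hp : p = 0
  · left
    filter_upwards [hpq, eventually_eval_xCoord_ne_zero hq] with P h1 h2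
    simpa [hp, h2, sub_eq_zero] using h1
  · right
    filter_upwards [hpq, eventually_eval_xCoord_ne_zero hp] with P h1 h2 h3
    refine h2 ?_
    rw [← h1, h3, sub_self, zero_mul]

lemma hCoord_sq : IsRat fun P : W.Point ↦ hCoord P ^ 2 :=
  (eval_xCoord (hSq W)).congr <| by
    filter_upwards [eventually_ne_zero] with P hP
    rw [eval_hSq hP]

end IsRat

end Generic

/-! ### Subgroups with cofinite union -/

section CofiniteUnion

variable {G : Type*} [AddCommGroup G] [Infinite G]

lemma infinite_compl_of_ne_top {H : AddSubgroup G} (hH : H ≠ ⊤) : {g | g ∉ H}.Infinite := by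
  intro hfin
  obtain ⟨g, hg⟩ : ∃ g, g ∉ H := by
    by_contra! h
    exact hH (eq_top_iff.mpr fun g _ ↦ h g)
  have hH' : (H : Set G).Finite := by
    refine Set.Finite.of_injOn (f := fun h ↦ g + h) (t := {g | g ∉ H})
      (fun h hh (hgh : g + h ∈ H) ↦ hg ?_)
      (add_right_injective g).injOn hfin
    simpa using H.sub_mem hgh hh
  refine Set.infinite_univ (α := G) ((hH'.union hfin).subset fun x _ ↦ ?_)
  by_cases hx : x ∈ H
  · exact Or.inl hx
  · exact Or.inr hx

/-- If two subgroups of an infinite abelian group cover all but finitely many elements, then one of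
them is the whole group. -/
lemma eq_top_or_eq_top_of_cofinite {H₁ H₂ : AddSubgroup G}
    (h : ∀ᶠ g in cofinite, g ∈ H₁ ∨ g ∈ H₂) : H₁ = ⊤ ∨ H₂ = ⊤ := by
  by_contra! hne
  have i1 := infinite_compl_of_ne_top hne.1
  have i2 := infinite_compl_of_ne_top hne.2
  rw [eventually_cofinite] at h
  obtain ⟨a, ha, ha'⟩ := (i1.sdiff h).nonempty
  have ha2 : a ∈ H₂ := by
    by_contra h2
    exact ha' (by simpa using ⟨ha, h2⟩)
  -- For almost all `b ∉ H₂` we have `b ∈ H₁`, so that `a + b` lies in neither subgroup.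
  have i3 := i2.sdiff h
  refine (i3.image (add_right_injective a).injOn) (h.subset ?_)
  rintro _ ⟨b, ⟨hb, hb'⟩, rfl⟩
  have hb1 : b ∈ H₁ := by
    by_contra h2
    exact hb' (by simpa using ⟨h2, hb⟩)
  change ¬ (a + b ∈ H₁ ∨ a + b ∈ H₂)
  rw [H₁.add_mem_cancel_right hb1, H₂.add_mem_cancel_left ha2]
  exact not_or.mpr ⟨ha, hb⟩

variable {G' : Type*} [AddCommGroup G']

lemma eq_or_eq_neg_of_eventually {φ ψ : G →+ G'}
    (h : ∀ᶠ g in cofinite, φ g = ψ g ∨ φ g = -ψ g) : φ = ψ ∨ φ = -ψ := by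
  rcases eq_top_or_eq_top_of_cofinite (H₁ := φ.eqLocus ψ) (H₂ := φ.eqLocus (-ψ)) h with h | h
  · exact Or.inl (AddMonoidHom.ext fun g ↦ (h ▸ AddSubgroup.mem_top g : g ∈ φ.eqLocus ψ))
  · exact Or.inr (AddMonoidHom.ext fun g ↦ (h ▸ AddSubgroup.mem_top g : g ∈ φ.eqLocus (-ψ)))

lemma eq_of_eventually_eq {φ ψ : G →+ G'} (h : ∀ᶠ g in cofinite, φ g = ψ g) : φ = ψ := by
  rcases eq_top_or_eq_top_of_cofinite (H₁ := φ.eqLocus ψ) (H₂ := φ.eqLocus ψ)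
    (h.mono fun g hg ↦ Or.inl hg) with h | h <;>
  exact AddMonoidHom.ext fun g ↦ (h ▸ AddSubgroup.mem_top g : g ∈ φ.eqLocus ψ)

end CofiniteUnion

/-! ### Rational endomorphisms -/

section End

variable {G : Type*} [AddCommGroup G]

@[simp] lemma end_add_apply (φ ψ : AddMonoid.End G) (P : G) : (φ + ψ) P = φ P + ψ P := rfl

@[simp] lemma end_neg_apply (φ : AddMonoid.End G) (P : G) : (-φ) P = -φ P := rfl

@[simp] lemma end_sub_apply (φ ψ : AddMonoid.End G) (P : G) : (φ - ψ) P = φ P - ψ P := rfl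

@[simp] lemma end_mul_apply (φ ψ : AddMonoid.End G) (P : G) : (φ * ψ) P = φ (ψ P) := rfl

lemma end_nsmul_apply (n : ℕ) (φ : AddMonoid.End G) (P : G) : (n • φ) P = n • φ P := rfl

end End

section Rational

variable {K : Type*} [Field K] [DecidableEq K] {W : WeierstrassCurve.Affine K}

/-- A group endomorphism of the points of the curve is *rational* if it is zero or if, away from
finitely many points, it has the shape `(x, h) ↦ (R(x), S(x) h)` with rational functions `R`, `S`,
where `h = 2y + a₁x + a₃`. -/
def IsRational (φ : AddMonoid.End W.Point) : Prop :=
  φ = 0 ∨ ((∀ᶠ P in cofinite, φ P ≠ 0) ∧ IsRat (fun P ↦ xCoord (φ P)) ∧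
    IsRat fun P ↦ hCoord (φ P) / hCoord P)

namespace IsRational

variable {φ ψ : AddMonoid.End W.Point}

lemma zero : IsRational (0 : AddMonoid.End W.Point) := Or.inl rfl

lemma eventually_ne_zero (h : IsRational φ) (h0 : φ ≠ 0) : ∀ᶠ P in cofinite, φ P ≠ 0 :=
  (h.resolve_left h0).1

lemma xCoord (h : IsRational φ) : IsRat fun P ↦ xCoord (φ P) := by
  rcases h with rfl | h
  · exact IsRat.const 0
  · exact h.2.1

lemma hCoord_div (h : IsRational φ) : IsRat fun P ↦ hCoord (φ P) / hCoord P := by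
  rcases h with rfl | h
  · exact (IsRat.const 0).congr (by simp)
  · exact h.2.2

lemma finite_ker (h : IsRational φ) (h0 : φ ≠ 0) : {P | φ P = 0}.Finite := by
  simpa [eventually_cofinite] using h.eventually_ne_zero h0

/-- A nonzero rational endomorphism has finite fibres. -/
lemma tendsto_cofinite (h : IsRational φ) (h0 : φ ≠ 0) : Tendsto φ cofinite cofinite := by
  refine Tendsto.cofinite_of_finite_preimage_singleton fun Q ↦ ?_
  change {P | φ P = Q}.Finite
  by_cases hQ : ∃ P, φ P = Q
  · obtain ⟨P, rfl⟩ := hQ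
    refine ((h.finite_ker h0).image (P + ·)).subset fun R (hR : φ R = φ P) ↦
      ⟨R - P, ?_, by simp⟩
    change φ (R - P) = 0
    rw [map_sub, hR, sub_self]
  · push Not at hQ
    convert Set.finite_empty
    ext P
    simp [hQ P]

lemma neg (h : IsRational φ) : IsRational (-φ) := by
  rcases h with rfl | ⟨h1, h2, h3⟩
  · exact Or.inl neg_zero
  · refine Or.inr ⟨?_, ?_, ?_⟩
    · simpa using h1
    · simpa using h2
    · simpa [neg_div] using h3.neg

variable [CharZero K]

lemma one : IsRational (1 : AddMonoid.End W.Point) := by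
  refine Or.inr ⟨EllipticCM.eventually_ne_zero, IsRat.xCoord, ?_⟩
  refine (IsRat.const 1).congr ?_
  filter_upwards [eventually_hCoord_ne_zero] with P hP
  exact div_self hP

lemma add_self (h : IsRational φ) (h0 : φ ≠ 0) : IsRational (φ + φ) := by
  have hh : ∀ᶠ P in cofinite, hCoord (φ P) ≠ 0 :=
    (h.tendsto_cofinite h0).eventually eventually_hCoord_ne_zero
  -- The slope of the tangent at `φ P`, divided by `hCoord P`.
  have hs : IsRat fun P ↦ ((6 * EllipticCM.xCoord (φ P) ^ 2 + W.b₂ * EllipticCM.xCoord (φ P)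
      + W.b₄) / (hCoord (φ P) / hCoord P)) / hCoord P ^ 2 :=
    (((((IsRat.const 6).mul (h.xCoord.pow 2)).add ((IsRat.const W.b₂).mul h.xCoord)).add
      (IsRat.const W.b₄)).div h.hCoord_div).div IsRat.hCoord_sq
  have hx : IsRat fun P ↦ EllipticCM.xCoord ((φ + φ) P) := by
    refine (((((hs.pow 2).mul IsRat.hCoord_sq).div (IsRat.const 4)).sub
      (IsRat.const (W.b₂ / 4))).sub ((IsRat.const 2).mul h.xCoord)).congr ?_
    filter_upwards [hh, eventually_hCoord_ne_zero] with P h1 h2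
    rw [end_add_apply, xCoord_add_self h1]
    field_simp
  refine Or.inr ⟨hh.mono fun P ↦ add_self_ne_zero, hx, ?_⟩
  refine ((hs.mul (h.xCoord.sub hx)).sub h.hCoord_div).congr ?_
  filter_upwards [hh, eventually_hCoord_ne_zero] with P h1 h2
  simp only [end_add_apply]
  rw [hCoord_add_self h1]
  field_simp

lemma add_of_eventually_ne (h : IsRational φ) (h' : IsRational ψ) (h0 : φ ≠ 0) (h0' : ψ ≠ 0)
    (hx : ∀ᶠ P in cofinite, EllipticCM.xCoord (φ P) ≠ EllipticCM.xCoord (ψ P)) :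
    IsRational (φ + ψ) := by
  -- The slope of the chord through `φ P` and `ψ P`, divided by `hCoord P`.
  have hs : IsRat fun P ↦ (hCoord (φ P) / hCoord P - hCoord (ψ P) / hCoord P) /
      (EllipticCM.xCoord (φ P) - EllipticCM.xCoord (ψ P)) :=
    (h.hCoord_div.sub h'.hCoord_div).div (h.xCoord.sub h'.xCoord)
  have hx' : IsRat fun P ↦ EllipticCM.xCoord ((φ + ψ) P) := by
    refine (((((hs.pow 2).mul IsRat.hCoord_sq).div (IsRat.const 4)).sub
      (IsRat.const (W.b₂ / 4))).sub h.xCoord).sub h'.xCoord |>.congr ?_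
    filter_upwards [hx, eventually_hCoord_ne_zero, h.eventually_ne_zero h0,
      h'.eventually_ne_zero h0'] with P h1 h2 h3 h4
    rw [end_add_apply, xCoord_add h3 h4 h1]
    have := sub_ne_zero.mpr h1
    field_simp
  refine Or.inr ⟨hx.mono fun P ↦ add_ne_zero_of_xCoord_ne, hx', ?_⟩
  refine ((hs.mul (h.xCoord.sub hx')).sub h.hCoord_div).congr ?_
  filter_upwards [hx, eventually_hCoord_ne_zero, h.eventually_ne_zero h0,
      h'.eventually_ne_zero h0'] with P h1 h2 h3 h4
  simp only [end_add_apply]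
  rw [hCoord_add h3 h4 h1]
  have := sub_ne_zero.mpr h1
  field_simp

variable [IsAlgClosed K] [W.IsElliptic]

omit [CharZero K] in
/-- Two rational endomorphisms that do not agree up to sign have different `x`-coordinates almost
everywhere. -/
lemma eventually_xCoord_ne (h : IsRational φ) (h' : IsRational ψ) (h0 : φ ≠ 0) (h0' : ψ ≠ 0)
    (hne : φ ≠ ψ) (hne' : φ ≠ -ψ) :
    ∀ᶠ P in cofinite, EllipticCM.xCoord (φ P) ≠ EllipticCM.xCoord (ψ P) := by
  rcases (h.xCoord.sub h'.xCoord).eventually_eq_or_ne 0 with h1 | h1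
  · refine ((eq_or_eq_neg_of_eventually (φ := φ) (ψ := ψ) ?_).elim hne hne').elim
    filter_upwards [h1, h.eventually_ne_zero h0, h'.eventually_ne_zero h0'] with P h2 h3 h4
    exact eq_or_eq_neg_of_xCoord_eq h3 h4 (sub_eq_zero.mp h2)
  · exact h1.mono fun P ↦ sub_ne_zero.mp

lemma add (h : IsRational φ) (h' : IsRational ψ) : IsRational (φ + ψ) := by
  by_cases h0 : φ = 0
  · rwa [h0, zero_add]
  by_cases h0' : ψ = 0
  · rwa [h0', add_zero]
  by_cases hne : φ = ψ
  · subst hne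
    exact add_self h h0
  by_cases hne' : φ = -ψ
  · rw [hne', neg_add_cancel]
    exact zero
  exact add_of_eventually_ne h h' h0 h0' (eventually_xCoord_ne h h' h0 h0' hne hne')

lemma sub (h : IsRational φ) (h' : IsRational ψ) : IsRational (φ - ψ) := by
  rw [sub_eq_add_neg]
  exact h.add h'.neg

lemma natCast (n : ℕ) : IsRational (n : AddMonoid.End W.Point) := by
  induction n with
  | zero => simpa using zero
  | succ n ih => simpa using ih.add one

lemma intCast (n : ℤ) : IsRational (n : AddMonoid.End W.Point) := by
  rcases n with n | n
  · simpa using natCast n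
  · simpa only [Int.cast_negSucc] using (natCast _).neg

end IsRational

end Rational

/-! ### The degree of a rational endomorphism -/

section Degree

variable {K : Type*} [Field K] {W : WeierstrassCurve.Affine K}

/-- The function `g` is almost everywhere the quotient of the coprime polynomials `p` and `q` in the
`x`-coordinate. -/
structure IsReduced (g : W.Point → K) (p q : K[X]) : Prop where
  isCoprime : IsCoprime p q
  ne_zero : q ≠ 0
  eventually : ∀ᶠ P in cofinite, g P * q.eval (xCoord P) = p.eval (xCoord P)

lemma IsRat.exists_isReduced [DecidableEq K] {g : W.Point → K} (hg : IsRat g) :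
    ∃ p q, IsReduced g p q := by
  obtain ⟨p, q, hq, hpq⟩ := hg
  obtain ⟨p', hp'⟩ := EuclideanDomain.gcd_dvd_left p q
  obtain ⟨q', hq'⟩ := EuclideanDomain.gcd_dvd_right p q
  have hgcd : EuclideanDomain.gcd p q ≠ 0 := fun h ↦ hq (EuclideanDomain.gcd_eq_zero_iff.mp h).2
  have hq0 : q' ≠ 0 := by rintro rfl; exact hq (by rw [hq', mul_zero])
  refine ⟨p', q', ?_, hq0, ?_⟩
  · refine ⟨EuclideanDomain.gcdA p q, EuclideanDomain.gcdB p q, mul_left_cancel₀ hgcd ?_⟩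
    have := EuclideanDomain.gcd_eq_gcd_ab p q
    linear_combination -this - EuclideanDomain.gcdA p q * hp' - EuclideanDomain.gcdB p q * hq'
  · filter_upwards [hpq, eventually_eval_xCoord_ne_zero hgcd] with P h1 h2
    have h3 := congrArg (fun r ↦ r.eval (EllipticCM.xCoord P)) hp'
    have h4 := congrArg (fun r ↦ r.eval (EllipticCM.xCoord P)) hq'
    simp only [eval_mul] at h3 h4
    refine mul_left_cancel₀ h2 ?_
    linear_combination h1 + h3 - g P * h4

variable [IsAlgClosed K] [W.IsElliptic]

/-- Every representation of a function as a quotient of polynomials is obtained by expanding the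
reduced one. -/
lemma IsReduced.exists_eq_mul {g : W.Point → K} {p q a b : K[X]} (h : IsReduced g p q) (hb : b ≠ 0)
    (hab : ∀ᶠ P in cofinite, g P * b.eval (xCoord P) = a.eval (xCoord P)) :
    ∃ e ≠ 0, a = p * e ∧ b = q * e := by
  have h1 : p * b - a * q = 0 := by
    refine eq_zero_of_eventually_eval_xCoord (W := W) ?_
    filter_upwards [h.eventually, hab] with P h1 h2
    simp only [eval_sub, eval_mul, ← h1, ← h2]
    ring
  obtain ⟨e, rfl⟩ : q ∣ b :=
    h.isCoprime.symm.dvd_of_dvd_mul_left ⟨a, by linear_combination h1⟩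
  refine ⟨e, right_ne_zero_of_mul hb, ?_, rfl⟩
  refine mul_left_cancel₀ h.ne_zero ?_
  linear_combination -h1

open Classical in
/-- The degree of a rational function of the `x`-coordinate, namely the larger one of the degrees of
numerator and denominator in lowest terms; the junk value is `0` for other functions. -/
noncomputable def ratDegree (g : W.Point → K) : ℕ :=
  if h : ∃ pq : K[X] × K[X], IsReduced g pq.1 pq.2 then
    max h.choose.1.natDegree h.choose.2.natDegree
  else 0

lemma IsReduced.natDegree_le {g : W.Point → K} {p q a b : K[X]} (h : IsReduced g p q)
    (hb : b ≠ 0) (hab : ∀ᶠ P in cofinite, g P * b.eval (xCoord P) = a.eval (xCoord P)) :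
    max p.natDegree q.natDegree ≤ max a.natDegree b.natDegree := by
  obtain ⟨e, he, rfl, rfl⟩ := h.exists_eq_mul hb hab
  refine max_le_max ?_ ?_
  · by_cases hp : p = 0
    · simp [hp]
    · exact natDegree_le_of_dvd (dvd_mul_right p e) (mul_ne_zero hp he)
  · exact natDegree_le_of_dvd (dvd_mul_right q e) (mul_ne_zero h.ne_zero he)

lemma IsReduced.ratDegree_eq {g : W.Point → K} {p q : K[X]} (h : IsReduced g p q) :
    ratDegree g = max p.natDegree q.natDegree := by
  have h' : ∃ pq : K[X] × K[X], IsReduced g pq.1 pq.2 := ⟨(p, q), h⟩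
  rw [ratDegree, dif_pos h']
  exact le_antisymm (h'.choose_spec.natDegree_le h.ne_zero h.eventually)
    (h.natDegree_le h'.choose_spec.ne_zero h'.choose_spec.eventually)

lemma ratDegree_le [DecidableEq K] {g : W.Point → K} {a b : K[X]} (hb : b ≠ 0)
    (hab : ∀ᶠ P in cofinite, g P * b.eval (xCoord P) = a.eval (xCoord P)) :
    ratDegree g ≤ max a.natDegree b.natDegree := by
  obtain ⟨p, q, h⟩ := IsRat.exists_isReduced (g := g) ⟨a, b, hb, hab⟩
  rw [h.ratDegree_eq]
  exact h.natDegree_le hb hab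

variable [DecidableEq K]

/-- The degree of an endomorphism `φ` is the degree of the rational function `x ∘ φ` of `x`. The
zero endomorphism has degree `0`. -/
noncomputable def deg (φ : AddMonoid.End W.Point) : ℕ := ratDegree fun P ↦ xCoord (φ P)

omit [IsAlgClosed K] [W.IsElliptic] in
lemma deg_neg (φ : AddMonoid.End W.Point) : deg (-φ) = deg φ := by
  simp [deg]

lemma deg_zero : deg (0 : AddMonoid.End W.Point) = 0 := by
  have : IsReduced (fun P : W.Point ↦ xCoord ((0 : AddMonoid.End W.Point) P)) 0 1 :=
    ⟨isCoprime_one_right, one_ne_zero, by simp⟩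
  rw [deg, this.ratDegree_eq]
  simp

lemma deg_one : deg (1 : AddMonoid.End W.Point) = 1 := by
  have : IsReduced (fun P : W.Point ↦ xCoord ((1 : AddMonoid.End W.Point) P)) X 1 :=
    ⟨isCoprime_one_right, one_ne_zero, by simp⟩
  rw [deg, this.ratDegree_eq]
  simp

namespace IsRational

variable {φ ψ : AddMonoid.End W.Point}

/-- The rational function `x ∘ φ` of a nonzero `φ` is not constant. -/
lemma sub_C_mul_ne_zero (h : IsRational φ) (h0 : φ ≠ 0) {p q : K[X]}
    (hpq : IsReduced (fun P ↦ EllipticCM.xCoord (φ P)) p q) (c : K) : p - C c * q ≠ 0 := by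
  intro hc
  have h1 := (tendsto_xCoord_cofinite.comp (h.tendsto_cofinite h0)).eventually
    (eventually_cofinite_ne c)
  obtain ⟨P, h2, h3, h4⟩ :=
    (h1.and (hpq.eventually.and (eventually_eval_xCoord_ne_zero hpq.ne_zero))).exists
  refine h2 (mul_right_cancel₀ h4 ?_)
  simp only [Function.comp_apply]
  rw [h3, sub_eq_zero.mp hc, eval_mul, eval_C]

lemma eventually_natDegree_ne_zero (h : IsRational φ) (h0 : φ ≠ 0) {p q : K[X]}
    (hpq : IsReduced (fun P ↦ EllipticCM.xCoord (φ P)) p q) :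
    ∀ᶠ c in cofinite, (p - C c * q).natDegree ≠ 0 := by
  rw [eventually_cofinite]
  refine Set.Subsingleton.finite fun c hc c' hc' ↦ ?_
  simp only [Set.mem_ofPred_eq, not_not] at hc hc'
  by_contra hne
  obtain ⟨k, hk⟩ := natDegree_eq_zero.mp hc
  obtain ⟨k', hk'⟩ := natDegree_eq_zero.mp hc'
  have hs := sub_ne_zero.mpr hne
  -- The difference of the two constant polynomials shows that `q`, hence also `p`, is constant.
  have hq : C (k' - k) = C (c - c') * q := by
    rw [C_sub, C_sub, hk, hk']
    ring
  have hk0 : k' - k ≠ 0 := by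
    intro h
    rw [h, C_0, eq_comm, mul_eq_zero, C_eq_zero] at hq
    exact hq.elim hs hpq.ne_zero
  refine h.sub_C_mul_ne_zero h0 hpq (c + k * (c - c') / (k' - k)) ?_
  have : C (k * (c - c') / (k' - k)) * q = C k := by
    rw [mul_div_right_comm, C_mul, mul_assoc, ← hq, ← C_mul, div_mul_cancel₀ _ hk0]
  rw [C_add, add_mul, this, hk]
  ring

/-- A nonzero rational endomorphism is surjective. -/
lemma surjective (h : IsRational φ) (h0 : φ ≠ 0) : Function.Surjective φ := by
  obtain ⟨p, q, hpq⟩ := h.xCoord.exists_isReduced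
  have hB := hpq.eventually.and (h.eventually_ne_zero h0)
  rw [eventually_cofinite] at hB
  have hB' : ∀ᶠ Q : W.Point in cofinite, ∀ b ∈ {P : W.Point | ¬ (EllipticCM.xCoord (φ P) *
      q.eval (EllipticCM.xCoord P) = p.eval (EllipticCM.xCoord P) ∧ φ P ≠ 0)},
      (C (p.eval (EllipticCM.xCoord b)) - C (q.eval (EllipticCM.xCoord b)) * X).eval
        (EllipticCM.xCoord Q) ≠ 0 := by
    rw [eventually_all_finite hB]
    intro b _
    refine eventually_eval_xCoord_ne_zero fun hb ↦ ?_
    have e0 := congrArg (fun r ↦ r.coeff 0) hb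
    have e1 := congrArg (fun r ↦ r.coeff 1) hb
    simp at e0 e1
    obtain ⟨u, v, huv⟩ := hpq.isCoprime
    have := congrArg (fun r ↦ r.eval (EllipticCM.xCoord b)) huv
    simp [e0, e1] at this
  have key : ∀ᶠ Q : W.Point in cofinite, ∃ P, φ P = Q := by
    filter_upwards [hB', EllipticCM.eventually_ne_zero, tendsto_xCoord_cofinite.eventually
      (h.eventually_natDegree_ne_zero h0 hpq)] with Q h1 h2 h3
    obtain ⟨x₀, hx₀⟩ := IsAlgClosed.exists_root (p - C (EllipticCM.xCoord Q) * q)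
      (fun hd ↦ h3 (natDegree_eq_of_degree_eq_some hd))
    obtain ⟨P, hP, rfl⟩ := exists_xCoord_eq (W := W) x₀
    simp only [IsRoot, eval_sub, eval_mul, eval_C] at hx₀
    have hPB := not_imp_not.mpr (h1 P) (by
      simp only [eval_sub, eval_mul, eval_C, eval_X, not_not]
      linear_combination hx₀)
    simp only [not_not] at hPB
    have hq0 : q.eval (EllipticCM.xCoord P) ≠ 0 := by
      intro hq0
      obtain ⟨u, v, huv⟩ := hpq.isCoprime
      have := congrArg (fun r ↦ r.eval (EllipticCM.xCoord P)) huv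
      rw [hq0, mul_zero, sub_zero] at hx₀
      simp [hq0, hx₀] at this
    have hx : EllipticCM.xCoord (φ P) = EllipticCM.xCoord Q :=
      mul_right_cancel₀ hq0 (by linear_combination hPB.1 + hx₀)
    rcases eq_or_eq_neg_of_xCoord_eq hPB.2 h2 hx with h4 | h4
    · exact ⟨P, h4⟩
    · exact ⟨-P, by rw [map_neg, h4, neg_neg]⟩
  have : AddMonoidHom.range φ = ⊤ := or_self_iff.mp
    (eq_top_or_eq_top_of_cofinite (key.mono fun Q hQ ↦ Or.inl hQ))
  exact AddMonoidHom.range_eq_top.mp this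

/-- The kernel of a nonzero rational endomorphism has at most `deg φ` elements. In fact the fibre of
`φ` over a general point `Q` injects, by the `x`-coordinate, into the solutions of
`x ∘ φ = x(Q)`. -/
lemma ncard_ker_le [CharZero K] (h : IsRational φ) (h0 : φ ≠ 0) :
    {P | φ P = 0}.ncard ≤ deg φ := by
  obtain ⟨p, q, hpq⟩ := h.xCoord.exists_isReduced
  have hB := hpq.eventually
  rw [eventually_cofinite] at hB
  obtain ⟨Q, hQ, hQ0⟩ := ((hB.image φ).eventually_cofinite_notMem.and
    eventually_hCoord_ne_zero).exists
  obtain ⟨P₀, rfl⟩ := h.surjective h0 Q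
  have hr := h.sub_C_mul_ne_zero h0 hpq (EllipticCM.xCoord (φ P₀))
  have hle : {P | φ P = 0}.ncard ≤
      ((p - C (EllipticCM.xCoord (φ P₀)) * q).roots.toFinset : Set K).ncard := by
    refine Set.ncard_le_ncard_of_injOn (fun P ↦ EllipticCM.xCoord (P₀ + P)) ?_ ?_
      (Finset.finite_toSet _)
    · intro P (hP : φ P = 0)
      have hφ : φ (P₀ + P) = φ P₀ := by rw [map_add, hP, add_zero]
      have : EllipticCM.xCoord (φ (P₀ + P)) * q.eval (EllipticCM.xCoord (P₀ + P)) =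
          p.eval (EllipticCM.xCoord (P₀ + P)) := by
        by_contra hc
        exact hQ ⟨P₀ + P, hc, hφ⟩
      rw [hφ] at this
      simp [hr, this]
    · intro P (hP : φ P = 0) P' (hP' : φ P' = 0) hPP'
      have hφ : φ (P₀ + P) = φ P₀ := by rw [map_add, hP, add_zero]
      have hφ' : φ (P₀ + P') = φ P₀ := by rw [map_add, hP', add_zero]
      have hn : ∀ R, φ R = φ P₀ → R ≠ 0 := by
        rintro R hR rfl
        rw [map_zero] at hR
        exact hQ0 (by rw [← hR, hCoord_zero])
      rcases eq_or_eq_neg_of_xCoord_eq (hn _ hφ) (hn _ hφ') hPP' with h1 | h1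
      · exact add_left_cancel h1
      · exfalso
        have h2 : φ P₀ = -φ P₀ := by rw [← hφ', ← map_neg, ← h1, hφ, hφ']
        have h3 := congrArg hCoord h2
        rw [hCoord_neg, eq_neg_iff_add_eq_zero, ← two_mul, mul_eq_zero] at h3
        exact h3.elim two_ne_zero hQ0
  rw [Set.ncard_coe_finset] at hle
  refine hle.trans ((Multiset.toFinset_card_le _).trans ((card_roots' _).trans ?_))
  rw [deg, hpq.ratDegree_eq]
  refine (natDegree_sub_le _ _).trans (max_le_max le_rfl (natDegree_C_mul_le _ _))

end IsRational

end Degree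

/-! ### The parallelogram inequality -/

section Parallelogram

section Polynomial

variable {K : Type*} [Field K]

/-- Gauss's lemma for the symmetric functions `u₁/v₁ + u₂/v₂` and `u₁u₂/(v₁v₂)` of two fractions in
lowest terms: a common denominator of both is divisible by `v₁v₂`. -/
lemma mul_dvd_of_isCoprime {u₁ v₁ u₂ v₂ D S T : K[X]} (h₁ : IsCoprime u₁ v₁)
    (h₂ : IsCoprime u₂ v₂) (hS : D * (u₁ * v₂ + u₂ * v₁) = S * (v₁ * v₂))
    (hT : D * (u₁ * u₂) = T * (v₁ * v₂)) : v₁ * v₂ ∣ D := by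
  obtain ⟨a, b, hab⟩ := h₁
  obtain ⟨c, d, hcd⟩ := h₂
  -- Modulo `v₁v₂`, the ideal generated by `u₁v₂ + u₂v₁` and `u₁u₂` is the unit ideal, since the
  -- product of the two squared Bézout relations lies in it.
  have h1 : v₁ * v₂ ∣ D * (u₁ * v₂ + u₂ * v₁) := hS ▸ dvd_mul_left _ _
  have h2 : v₁ * v₂ ∣ D * (u₁ * u₂) := hT ▸ dvd_mul_left _ _
  have h3 : v₁ * v₂ ∣ D * (v₁ * v₂) := dvd_mul_left _ _
  have h4 : v₁ * v₂ ∣ D * (u₁ * v₂) ^ 2 := by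
    have : D * (u₁ * v₂) ^ 2 = D * (u₁ * v₂ + u₂ * v₁) * (u₁ * v₂)
      - D * (v₁ * v₂) * (u₁ * u₂) := by ring
    rw [this]
    exact dvd_sub (h1.mul_right _) (h3.mul_right _)
  have h5 : v₁ * v₂ ∣ D * (u₂ * v₁) ^ 2 := by
    have : D * (u₂ * v₁) ^ 2 = D * (u₁ * v₂ + u₂ * v₁) * (u₂ * v₁)
      - D * (v₁ * v₂) * (u₁ * u₂) := by ring
    rw [this]
    exact dvd_sub (h1.mul_right _) (h3.mul_right _)
  have h6 : D = D * (u₁ * u₂) * (a ^ 2 * u₁ * c ^ 2 * u₂ + 2 * a * b * v₁ * c ^ 2 * u₂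
        + a ^ 2 * u₁ * 2 * c * d * v₂ + 4 * a * b * c * d * v₁ * v₂)
      + D * (u₁ * v₂) ^ 2 * (a ^ 2 * d ^ 2) + D * (u₂ * v₁) ^ 2 * (b ^ 2 * c ^ 2)
      + D * (v₁ * v₂) * (b ^ 2 * v₁ * d ^ 2 * v₂ + 2 * a * b * u₁ * d ^ 2 * v₂
        + b ^ 2 * v₁ * 2 * c * d * u₂) := by
    have h7 : D = D * (a * u₁ + b * v₁) ^ 2 * (c * u₂ + d * v₂) ^ 2 := by
      rw [hab, hcd]
      ring
    linear_combination h7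
  rw [h6]
  exact dvd_add (dvd_add (dvd_add (h2.mul_right _) (h4.mul_right _)) (h5.mul_right _))
    (h3.mul_right _)

/-- The degrees of two fractions add up under formation of the symmetric functions. -/
lemma max_natDegree_add_max_natDegree_le {u₁ v₁ u₂ v₂ : K[X]} {N : ℕ} (h₁ : v₁ ≠ 0) (h₂ : v₂ ≠ 0)
    (hs : (u₁ * v₂ + u₂ * v₁).natDegree ≤ N) (ht : (u₁ * u₂).natDegree ≤ N)
    (hv : (v₁ * v₂).natDegree ≤ N) :
    max u₁.natDegree v₁.natDegree + max u₂.natDegree v₂.natDegree ≤ N := by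
  rw [natDegree_mul h₁ h₂] at hv
  rcases le_or_gt u₁.natDegree v₁.natDegree with hd₁ | hd₁ <;>
  rcases le_or_gt u₂.natDegree v₂.natDegree with hd₂ | hd₂
  · rwa [max_eq_right hd₁, max_eq_right hd₂]
  · have hu₂ : u₂ ≠ 0 := by rintro rfl; simp at hd₂
    have e : (u₁ * v₂ + u₂ * v₁).natDegree = (u₂ * v₁).natDegree := by
      refine natDegree_add_eq_right_of_natDegree_lt ?_
      rw [natDegree_mul hu₂ h₁]
      exact natDegree_mul_le.trans_lt (by omega)
    rw [e, natDegree_mul hu₂ h₁] at hs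
    rw [max_eq_right hd₁, max_eq_left hd₂.le]
    omega
  · have hu₁ : u₁ ≠ 0 := by rintro rfl; simp at hd₁
    have e : (u₁ * v₂ + u₂ * v₁).natDegree = (u₁ * v₂).natDegree := by
      refine natDegree_add_eq_left_of_natDegree_lt ?_
      rw [natDegree_mul hu₁ h₂]
      exact natDegree_mul_le.trans_lt (by omega)
    rw [e, natDegree_mul hu₁ h₂] at hs
    rw [max_eq_right hd₂, max_eq_left hd₁.le]
    omega
  · have hu₁ : u₁ ≠ 0 := by rintro rfl; simp at hd₁
    have hu₂ : u₂ ≠ 0 := by rintro rfl; simp at hd₂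
    rw [natDegree_mul hu₁ hu₂] at ht
    rwa [max_eq_left hd₁.le, max_eq_left hd₂.le]

lemma natDegree_mul_le_of_le_of_le {p q : K[X]} {m n : ℕ} (hp : p.natDegree ≤ m)
    (hq : q.natDegree ≤ n) : (p * q).natDegree ≤ m + n :=
  natDegree_mul_le.trans (add_le_add hp hq)

lemma natDegree_sub_le_of_natDegree_le {p q : K[X]} {n : ℕ} (hp : p.natDegree ≤ n)
    (hq : q.natDegree ≤ n) : (p - q).natDegree ≤ n :=
  (natDegree_sub_le p q).trans (max_le hp hq)

end Polynomial

variable {K : Type*} [Field K] {W : WeierstrassCurve.Affine K} [IsAlgClosed K] [W.IsElliptic]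
  [DecidableEq K] [CharZero K] {φ ψ : AddMonoid.End W.Point}

namespace IsRational

lemma deg_add_self_le (h : IsRational φ) (h0 : φ ≠ 0) : deg (φ + φ) ≤ 4 * deg φ := by
  obtain ⟨p, q, hpq⟩ := h.xCoord.exists_isReduced
  have hh : ∀ᶠ P in cofinite, hCoord (φ P) ≠ 0 :=
    (h.tendsto_cofinite h0).eventually eventually_hCoord_ne_zero
  set b : K[X] := q * (C 4 * p ^ 3 + C W.b₂ * (p ^ 2 * q) + C (2 * W.b₄) * (p * q ^ 2)
    + C W.b₆ * q ^ 3) with hb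
  set a : K[X] := p ^ 4 - C W.b₄ * (p ^ 2 * q ^ 2) - C (2 * W.b₆) * (p * q ^ 3)
    - C W.b₈ * q ^ 4 with ha
  have hev : ∀ᶠ P in cofinite, EllipticCM.xCoord ((φ + φ) P) * b.eval (EllipticCM.xCoord P)
      = a.eval (EllipticCM.xCoord P) ∧ b.eval (EllipticCM.xCoord P) ≠ 0 := by
    filter_upwards [hh, hpq.eventually, h.eventually_ne_zero h0,
      eventually_eval_xCoord_ne_zero hpq.ne_zero] with P h1 h2 h3 h4
    have e1 := xCoord_add_self_mul h1
    have e2 := hCoord_sq h3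
    constructor
    · simp only [hb, ha, eval_add, eval_sub, eval_mul, eval_pow, eval_C, ← h2, end_add_apply]
      linear_combination (q.eval (EllipticCM.xCoord P)) ^ 4 * e1
    · have : b.eval (EllipticCM.xCoord P) =
          q.eval (EllipticCM.xCoord P) ^ 4 * hCoord (φ P) ^ 2 := by
        simp only [hb, eval_add, eval_mul, eval_pow, eval_C, ← h2]
        linear_combination -(q.eval (EllipticCM.xCoord P)) ^ 4 * e2
      rw [this]
      exact mul_ne_zero (pow_ne_zero _ h4) (pow_ne_zero _ h1)
  have hb0 : b ≠ 0 := by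
    rintro h0
    obtain ⟨P, -, hP⟩ := hev.exists
    simp [h0] at hP
  refine (ratDegree_le hb0 (hev.mono fun P hP ↦ hP.1)).trans ?_
  set d := deg φ with hd
  rw [deg, hpq.ratDegree_eq] at hd
  have hp : p.natDegree ≤ d := by omega
  have hq : q.natDegree ≤ d := by omega
  have hC : ∀ c : K, (C c).natDegree ≤ 0 := fun c ↦ (natDegree_C c).le
  have hP : ∀ n, (p ^ n).natDegree ≤ n * d := fun n ↦ natDegree_pow_le_of_le n hp
  have hQ : ∀ n, (q ^ n).natDegree ≤ n * d := fun n ↦ natDegree_pow_le_of_le n hq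
  have hm : ∀ {r s : K[X]} {m n k : ℕ}, r.natDegree ≤ m → s.natDegree ≤ n → m + n ≤ k →
    (r * s).natDegree ≤ k := fun h1 h2 h3 ↦ (natDegree_mul_le_of_le_of_le h1 h2).trans h3
  refine max_le ?_ ?_
  · exact natDegree_sub_le_of_natDegree_le (natDegree_sub_le_of_natDegree_le
      (natDegree_sub_le_of_natDegree_le (hP 4) (hm (hC _) (hm (hP 2) (hQ 2) le_rfl) (by omega)))
      (hm (hC _) (hm hp (hQ 3) le_rfl) (by omega))) (hm (hC _) (hQ 4) (by omega))
  · exact hm (n := 3 * d) hq (natDegree_add_le_of_degree_le (natDegree_add_le_of_degree_le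
      (natDegree_add_le_of_degree_le (hm (hC _) (hP 3) (by omega))
      (hm (hC _) (hm (hP 2) hq le_rfl) (by omega))) (hm (hC _) (hm hp (hQ 2) le_rfl) (by omega)))
      (hm (hC _) (hQ 3) (by omega))) (by omega)

lemma deg_add_add_deg_sub_le_of_ne (h : IsRational φ) (h' : IsRational ψ) (h0 : φ ≠ 0)
    (h0' : ψ ≠ 0) (hne : φ ≠ ψ) (hne' : φ ≠ -ψ) :
    deg (φ + ψ) + deg (φ - ψ) ≤ 2 * deg φ + 2 * deg ψ := by
  obtain ⟨p₁, q₁, h₁⟩ := h.xCoord.exists_isReduced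
  obtain ⟨p₂, q₂, h₂⟩ := h'.xCoord.exists_isReduced
  obtain ⟨u₁, v₁, k₁⟩ := (h.add h').xCoord.exists_isReduced
  obtain ⟨u₂, v₂, k₂⟩ := (h.sub h').xCoord.exists_isReduced
  have hx := h.eventually_xCoord_ne h' h0 h0' hne hne'
  set D : K[X] := (p₁ * q₂ - p₂ * q₁) ^ 2 with hD
  set S : K[X] := C 2 * (p₁ * p₂ * (p₁ * q₂ + p₂ * q₁)) + C W.b₂ * (p₁ * p₂ * (q₁ * q₂))
    + C W.b₄ * ((p₁ * q₂ + p₂ * q₁) * (q₁ * q₂)) + C W.b₆ * (q₁ * q₂) ^ 2 with hS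
  set T : K[X] := (p₁ * p₂) ^ 2 - C W.b₄ * (p₁ * p₂ * (q₁ * q₂))
    - C W.b₆ * ((p₁ * q₂ + p₂ * q₁) * (q₁ * q₂)) - C W.b₈ * (q₁ * q₂) ^ 2 with hT
  have hev : ∀ᶠ P : W.Point in cofinite,
      (D * (u₁ * v₂ + u₂ * v₁) - S * (v₁ * v₂)).eval (EllipticCM.xCoord P) = 0 ∧
      (D * (u₁ * u₂) - T * (v₁ * v₂)).eval (EllipticCM.xCoord P) = 0 ∧
      D.eval (EllipticCM.xCoord P) ≠ 0 := by
    filter_upwards [hx, h₁.eventually, h₂.eventually, k₁.eventually, k₂.eventually,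
      h.eventually_ne_zero h0, h'.eventually_ne_zero h0', eventually_eval_xCoord_ne_zero h₁.ne_zero,
      eventually_eval_xCoord_ne_zero h₂.ne_zero] with P hx e1 e2 e3 e4 z1 z2 n1 n2
    have es := xCoord_add_add_xCoord_sub z1 z2 hx
    have et := xCoord_add_mul_xCoord_sub z1 z2 hx
    simp only [end_add_apply, end_sub_apply] at e3 e4
    simp only [hD, hS, hT, eval_add, eval_sub, eval_mul, eval_pow, eval_C, ← e1, ← e2, ← e3, ← e4]
    generalize EllipticCM.xCoord (φ P) = x₁ at *
    generalize EllipticCM.xCoord (ψ P) = x₂ at *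
    generalize EllipticCM.xCoord (φ P + ψ P) = x₃ at *
    generalize EllipticCM.xCoord (φ P - ψ P) = x₄ at *
    generalize q₁.eval (EllipticCM.xCoord P) = r₁ at *
    generalize q₂.eval (EllipticCM.xCoord P) = r₂ at *
    generalize v₁.eval (EllipticCM.xCoord P) = s₁ at *
    generalize v₂.eval (EllipticCM.xCoord P) = s₂ at *
    refine ⟨?_, ?_, ?_⟩
    · linear_combination (r₁ * r₂) ^ 2 * (s₁ * s₂) * es
    · linear_combination (r₁ * r₂) ^ 2 * (s₁ * s₂) * et
    · refine pow_ne_zero _ ?_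
      rw [show x₁ * r₁ * r₂ - x₂ * r₂ * r₁ = (x₁ - x₂) * (r₁ * r₂) by ring]
      exact mul_ne_zero (sub_ne_zero.mpr hx) (mul_ne_zero n1 n2)
  have eS := sub_eq_zero.mp (eq_zero_of_eventually_eval_xCoord (hev.mono fun P hP ↦ hP.1))
  have eT := sub_eq_zero.mp (eq_zero_of_eventually_eval_xCoord (hev.mono fun P hP ↦ hP.2.1))
  have hD0 : D ≠ 0 := by
    intro h0
    obtain ⟨P, -, -, hP⟩ := hev.exists
    simp [h0] at hP
  obtain ⟨e, he⟩ := mul_dvd_of_isCoprime k₁.isCoprime k₂.isCoprime eS eT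
  have he0 : e ≠ 0 := by
    rintro rfl
    exact hD0 (by rw [he, mul_zero])
  have hv0 := mul_ne_zero k₁.ne_zero k₂.ne_zero
  have eS' : S = (u₁ * v₂ + u₂ * v₁) * e := by
    refine mul_right_cancel₀ hv0 ?_
    rw [← eS, he]
    ring
  have eT' : T = u₁ * u₂ * e := by
    refine mul_right_cancel₀ hv0 ?_
    rw [← eT, he]
    ring
  have hle : ∀ {r s : K[X]} {N : ℕ}, s = r * e → s.natDegree ≤ N → r.natDegree ≤ N := by
    rintro r s N rfl hN
    by_cases hr : r = 0
    · simp [hr]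
    · exact (natDegree_le_of_dvd (dvd_mul_right r e) (mul_ne_zero hr he0)).trans hN
  set d₁ := deg φ with hd₁
  set d₂ := deg ψ with hd₂
  rw [deg, h₁.ratDegree_eq] at hd₁
  rw [deg, h₂.ratDegree_eq] at hd₂
  have hp₁ : p₁.natDegree ≤ d₁ := by omega
  have hq₁ : q₁.natDegree ≤ d₁ := by omega
  have hp₂ : p₂.natDegree ≤ d₂ := by omega
  have hq₂ : q₂.natDegree ≤ d₂ := by omega
  have hC : ∀ {c : K} {r : K[X]} {n : ℕ}, r.natDegree ≤ n → (C c * r).natDegree ≤ n :=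
    fun h ↦ (natDegree_C_mul_le _ _).trans h
  have hpp := natDegree_mul_le_of_le_of_le hp₁ hp₂
  have hqq := natDegree_mul_le_of_le_of_le hq₁ hq₂
  have hpq : (p₁ * q₂ + p₂ * q₁).natDegree ≤ d₁ + d₂ :=
    natDegree_add_le_of_degree_le (natDegree_mul_le_of_le_of_le hp₁ hq₂)
      ((natDegree_mul_le_of_le_of_le hp₂ hq₁).trans (by omega))
  have hpq' : (p₁ * q₂ - p₂ * q₁).natDegree ≤ d₁ + d₂ :=
    natDegree_sub_le_of_natDegree_le (natDegree_mul_le_of_le_of_le hp₁ hq₂)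
      ((natDegree_mul_le_of_le_of_le hp₂ hq₁).trans (by omega))
  have hm : ∀ {r s : K[X]}, r.natDegree ≤ d₁ + d₂ → s.natDegree ≤ d₁ + d₂ →
      (r * s).natDegree ≤ 2 * d₁ + 2 * d₂ :=
    fun h1 h2 ↦ (natDegree_mul_le_of_le_of_le h1 h2).trans (by omega)
  have e1 := k₁.ratDegree_eq
  have e2 := k₂.ratDegree_eq
  rw [deg, deg, e1, e2]
  refine max_natDegree_add_max_natDegree_le k₁.ne_zero k₂.ne_zero (hle eS' ?_) (hle eT' ?_)
    (hle he ?_)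
  · rw [hS, pow_two]
    exact natDegree_add_le_of_degree_le (natDegree_add_le_of_degree_le
      (natDegree_add_le_of_degree_le (hC (hm hpp hpq)) (hC (hm hpp hqq))) (hC (hm hpq hqq)))
      (hC (hm hqq hqq))
  · rw [hT, pow_two, pow_two]
    exact natDegree_sub_le_of_natDegree_le (natDegree_sub_le_of_natDegree_le
      (natDegree_sub_le_of_natDegree_le (hm hpp hpp) (hC (hm hpp hqq))) (hC (hm hpq hqq)))
      (hC (hm hqq hqq))
  · rw [hD, pow_two]
    exact hm hpq' hpq'

/-- One half of the parallelogram law for the degree, which is a quadratic form. -/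
lemma deg_add_add_deg_sub_le (h : IsRational φ) (h' : IsRational ψ) :
    deg (φ + ψ) + deg (φ - ψ) ≤ 2 * deg φ + 2 * deg ψ := by
  by_cases h0 : φ = 0
  · rw [h0, zero_add, zero_sub, deg_neg, deg_zero]
    omega
  by_cases h0' : ψ = 0
  · rw [h0', add_zero, sub_zero, deg_zero]
    omega
  by_cases hne : φ = ψ
  · subst hne
    rw [sub_self, deg_zero]
    have := h.deg_add_self_le h0
    omega
  by_cases hne' : φ = -ψ
  · rw [← neg_eq_iff_eq_neg] at hne'
    subst hne'
    rw [add_neg_cancel, sub_neg_eq_add, deg_zero, deg_neg]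
    have := h.deg_add_self_le h0
    omega
  exact h.deg_add_add_deg_sub_le_of_ne h' h0 h0' hne hne'

end IsRational

lemma deg_natCast_le (n : ℕ) : deg (n : AddMonoid.End W.Point) ≤ n ^ 2 := by
  -- By the parallelogram inequality the difference `deg (n + 1) - deg n` grows by at most `2` in
  -- each step.
  suffices h : deg (n : AddMonoid.End W.Point) ≤ n ^ 2 ∧
      deg ((n + 1 : ℕ) : AddMonoid.End W.Point) ≤
        deg (n : AddMonoid.End W.Point) + (2 * n + 1) from h.1
  induction n with
  | zero => simp [deg_zero, deg_one]
  | succ n ih =>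
    obtain ⟨ih1, ih2⟩ := ih
    refine ⟨by nlinarith, ?_⟩
    have := (IsRational.natCast (W := W) (n + 1)).deg_add_add_deg_sub_le IsRational.one
    have e : ((n + 1 : ℕ) : AddMonoid.End W.Point) - 1 = (n : AddMonoid.End W.Point) := by
      rw [Nat.cast_succ, add_sub_cancel_right]
    rw [deg_one, ← Nat.cast_add_one, e] at this
    omega

lemma deg_intCast_le (n : ℤ) : (deg (n : AddMonoid.End W.Point) : ℤ) ≤ n ^ 2 := by
  obtain ⟨m, rfl | rfl⟩ := n.eq_nat_or_neg
  · exact_mod_cast deg_natCast_le m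
  · rw [Int.cast_neg, deg_neg, neg_sq]
    exact_mod_cast deg_natCast_le m

end Parallelogram

/-! ### Divisibility and torsion -/

section Torsion

variable {K : Type*} [Field K] {W : WeierstrassCurve.Affine K} [IsAlgClosed K] [W.IsElliptic]
  [DecidableEq K] [CharZero K]

lemma exists_two_torsion : ∃ P : W.Point, P ≠ 0 ∧ (2 : ℕ) • P = 0 := by
  obtain ⟨x, hx⟩ := IsAlgClosed.exists_root (hSq W) fun h ↦ by
    have := natDegree_eq_of_degree_eq_some h
    simp [natDegree_hSq] at this
  obtain ⟨P, hP, rfl⟩ := exists_xCoord_eq (W := W) x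
  refine ⟨P, hP, ?_⟩
  rw [two_nsmul, add_self_eq_zero_iff]
  right
  rwa [← sq_eq_zero_iff, ← eval_hSq hP]

lemma two_ne_zero_end : (2 : AddMonoid.End W.Point) ≠ 0 := by
  intro h
  obtain ⟨P, hP⟩ := (eventually_hCoord_ne_zero (W := W)).exists
  refine add_self_ne_zero hP ?_
  have := DFunLike.congr_fun h P
  rwa [← one_add_one_eq_two] at this

lemma natCast_ne_zero {n : ℕ} (hn : n ≠ 0) : (n : AddMonoid.End W.Point) ≠ 0 := by
  induction n using Nat.strong_induction_on with
  | _ n ih =>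
  intro h
  rcases Nat.even_or_odd' n with ⟨m, rfl | rfl⟩
  · -- Doubling is surjective, so that multiplication by `m` vanishes as well.
    refine ih m (by omega) (by omega) (AddMonoidHom.ext fun P ↦ ?_)
    have h2 : IsRational (2 : AddMonoid.End W.Point) := by simpa using IsRational.natCast (W := W) 2
    obtain ⟨Q, rfl⟩ := h2.surjective two_ne_zero_end P
    have := DFunLike.congr_fun h Q
    rw [mul_comm, Nat.cast_mul] at this
    exact this
  · -- An odd multiple of a nonzero `2`-torsion point is nonzero.
    obtain ⟨P, hP, hP2⟩ := exists_two_torsion (W := W)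
    have := DFunLike.congr_fun h P
    rw [AddMonoid.End.natCast_apply, succ_nsmul, mul_comm, mul_nsmul', hP2, smul_zero,
      zero_add] at this
    exact hP this

lemma exists_nsmul_eq {n : ℕ} (hn : n ≠ 0) (P : W.Point) : ∃ Q, n • Q = P :=
  (IsRational.natCast (W := W) n).surjective (natCast_ne_zero hn) P

lemma nsmul_end_eq_zero {n : ℕ} (hn : n ≠ 0) {φ : AddMonoid.End W.Point} (h : n • φ = 0) :
    φ = 0 := by
  refine AddMonoidHom.ext fun P ↦ ?_
  obtain ⟨Q, rfl⟩ := exists_nsmul_eq hn P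
  have := DFunLike.congr_fun h Q
  rw [end_nsmul_apply] at this
  exact (map_nsmul (φ : W.Point →+ W.Point) n Q).trans this

lemma nsmul_end_injective {n : ℕ} (hn : n ≠ 0) {φ ψ : AddMonoid.End W.Point}
    (h : n • φ = n • ψ) : φ = ψ := by
  rw [← sub_eq_zero]
  refine nsmul_end_eq_zero hn ?_
  rw [nsmul_sub, h, sub_self]

lemma finite_torsion {n : ℕ} (hn : n ≠ 0) : {P : W.Point | n • P = 0}.Finite :=
  (IsRational.natCast (W := W) n).finite_ker (natCast_ne_zero hn)

lemma ncard_torsion_le {n : ℕ} (hn : n ≠ 0) : {P : W.Point | n • P = 0}.ncard ≤ n ^ 2 :=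
  ((IsRational.natCast (W := W) n).ncard_ker_le (natCast_ne_zero hn)).trans (deg_natCast_le n)

/-- An endomorphism that kills the `n`-torsion is divisible by `n`. -/
lemma exists_eq_nsmul_of_torsion {n : ℕ} (hn : n ≠ 0) {φ : AddMonoid.End W.Point}
    (h : ∀ P, n • P = 0 → φ P = 0) : ∃ ψ, φ = n • ψ := by
  choose f hf using fun P : W.Point ↦ exists_nsmul_eq hn P
  have key : ∀ P Q, n • P = n • Q → φ P = φ Q := by
    intro P Q hPQ
    rw [← sub_eq_zero, ← map_sub]
    refine h _ ?_
    rw [smul_sub, hPQ, sub_self]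
  refine ⟨AddMonoidHom.mk' (fun P ↦ φ (f P)) fun P Q ↦ ?_, AddMonoidHom.ext fun P ↦ ?_⟩
  · rw [← map_add]
    refine key _ _ ?_
    rw [smul_add, hf, hf, hf]
  · change φ P = n • φ (f P)
    rw [← map_nsmul, hf]

lemma ncard_torsion_mul_ncard_torsion_le {m n : ℕ} (hm : m ≠ 0) (hn : n ≠ 0) :
    {P : W.Point | m • P = 0}.ncard * {P : W.Point | n • P = 0}.ncard ≤
      {P : W.Point | (m * n) • P = 0}.ncard := by
  choose f hf using fun P : W.Point ↦ exists_nsmul_eq hm P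
  rw [← Set.ncard_prod]
  refine Set.ncard_le_ncard_of_injOn (fun PQ ↦ PQ.1 + f PQ.2) ?_ ?_
    (finite_torsion (mul_ne_zero hm hn))
  · rintro ⟨P, Q⟩ ⟨hP : m • P = 0, hQ : n • Q = 0⟩
    change (m * n) • (P + f Q) = 0
    rw [smul_add, mul_nsmul, hP, mul_nsmul, hf, hQ, smul_zero, add_zero]
  · rintro ⟨P, Q⟩ ⟨hP : m • P = 0, -⟩ ⟨P', Q'⟩ ⟨hP' : m • P' = 0, -⟩ (h : P + f Q = P' + f Q')
    obtain rfl : Q = Q' := by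
      have := congrArg (fun R ↦ m • R) h
      simpa only [smul_add, hP, hP', hf, zero_add] using this
    rw [add_right_cancel h]

lemma ncard_torsion_pow_le {n : ℕ} (hn : n ≠ 0) (k : ℕ) :
    {P : W.Point | n • P = 0}.ncard ^ k ≤ {P : W.Point | (n ^ k) • P = 0}.ncard := by
  induction k with
  | zero => simp
  | succ k ih =>
    rw [pow_succ, pow_succ]
    exact (Nat.mul_le_mul_right _ ih).trans
      (ncard_torsion_mul_ncard_torsion_le (pow_ne_zero k hn) hn)

end Torsion

/-! ### The saturation of the ring of rational endomorphisms -/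

section Saturation

variable {K : Type*} [Field K] {W : WeierstrassCurve.Affine K} [DecidableEq K]

/-- The endomorphisms of the group of points some positive multiple of which is rational. -/
def IsAlmostRational (ψ : AddMonoid.End W.Point) : Prop :=
  ∃ n : ℕ, n ≠ 0 ∧ IsRational (n • ψ)

lemma IsRational.isAlmostRational {φ : AddMonoid.End W.Point} (h : IsRational φ) :
    IsAlmostRational φ := ⟨1, one_ne_zero, by simpa using h⟩

namespace IsAlmostRational

variable [IsAlgClosed K] [W.IsElliptic] [CharZero K] {φ ψ : AddMonoid.End W.Point}

lemma _root_.EllipticCM.IsRational.nsmul (h : IsRational φ) (n : ℕ) : IsRational (n • φ) := by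
  induction n with
  | zero => simpa using IsRational.zero
  | succ n ih => simpa only [succ_nsmul] using ih.add h

lemma add (h : IsAlmostRational φ) (h' : IsAlmostRational ψ) : IsAlmostRational (φ + ψ) := by
  obtain ⟨m, hm, h⟩ := h
  obtain ⟨n, hn, h'⟩ := h'
  refine ⟨m * n, mul_ne_zero hm hn, ?_⟩
  rw [nsmul_add, mul_nsmul, mul_nsmul']
  exact (h.nsmul n).add (h'.nsmul m)

omit [IsAlgClosed K] [W.IsElliptic] [CharZero K] in
lemma neg (h : IsAlmostRational φ) : IsAlmostRational (-φ) := by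
  obtain ⟨m, hm, h⟩ := h
  exact ⟨m, hm, by rw [neg_nsmul]; exact h.neg⟩

lemma sub (h : IsAlmostRational φ) (h' : IsAlmostRational ψ) : IsAlmostRational (φ - ψ) := by
  rw [sub_eq_add_neg]
  exact h.add h'.neg

omit [IsAlgClosed K] [W.IsElliptic] [CharZero K] in
lemma of_nsmul {n : ℕ} (hn : n ≠ 0) (h : IsAlmostRational (n • φ)) : IsAlmostRational φ := by
  obtain ⟨m, hm, h⟩ := h
  exact ⟨m * n, mul_ne_zero hm hn, by rwa [mul_nsmul']⟩

/-- A nonzero almost rational endomorphism is not divisible by all powers of `2`, since its kernel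
is finite. -/
lemma eq_zero_of_forall_two_pow (h : IsAlmostRational φ) (h2 : ∀ k : ℕ, ∃ ψ, φ = 2 ^ k • ψ) :
    φ = 0 := by
  obtain ⟨m, hm, h⟩ := h
  by_contra h0
  have h0' : m • φ ≠ 0 := fun h ↦ h0 (nsmul_end_eq_zero hm h)
  have hfin := h.finite_ker h0'
  have htwo : 2 ≤ {P : W.Point | 2 • P = 0}.ncard := by
    obtain ⟨P, hP, hP2⟩ := exists_two_torsion (W := W)
    exact (Set.one_lt_ncard (finite_torsion two_ne_zero)).mpr ⟨0, smul_zero _, P, hP2, hP.symm⟩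
  have hle : ∀ k, 2 ^ k ≤ {P | (m • φ) P = 0}.ncard := by
    intro k
    refine (Nat.pow_le_pow_left htwo k).trans ((ncard_torsion_pow_le two_ne_zero k).trans
      (Set.ncard_le_ncard ?_ hfin))
    intro P (hP : 2 ^ k • P = 0)
    obtain ⟨ψ, rfl⟩ := h2 k
    change m • (2 ^ k • ψ P) = 0
    rw [← map_nsmul (ψ : W.Point →+ W.Point), hP, map_zero, smul_zero]
  exact (hle _).not_gt Nat.lt_two_pow_self

end IsAlmostRational

end Saturation

/-! ### Morphisms are rational -/

section Morphism

variable {K : Type*} [Field K] {W : WeierstrassCurve.Affine K} [CharZero K]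

/-- The norm form of the extension generated by a square root of `hSq W` is anisotropic, for the
degree of `hSq W` is odd. -/
lemma sq_sub_mul_hSq_ne_zero {a b : K[X]} (h : ¬(a = 0 ∧ b = 0)) : a ^ 2 - b ^ 2 * hSq W ≠ 0 := by
  intro h0
  rw [sub_eq_zero] at h0
  by_cases hb : b = 0
  · exact h ⟨by simpa [hb] using h0, hb⟩
  · have h1 := congrArg natDegree h0
    rw [natDegree_mul (pow_ne_zero 2 hb) hSq_ne_zero, natDegree_pow, natDegree_pow,
      natDegree_hSq] at h1
    omega

lemma eventually_add_mul_hCoord_ne_zero {a b : K[X]} (h : ¬(a = 0 ∧ b = 0)) :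
    ∀ᶠ P : W.Point in cofinite, a.eval (xCoord P) + b.eval (xCoord P) * hCoord P ≠ 0 := by
  filter_upwards [eventually_ne_zero, eventually_eval_xCoord_ne_zero
    (sq_sub_mul_hSq_ne_zero (W := W) h)] with P hP h1 h2
  refine h1 ?_
  simp only [eval_sub, eval_mul, eval_pow, eval_hSq hP]
  linear_combination (a.eval (xCoord P) - b.eval (xCoord P) * hCoord P) * h2

lemma exists_eval_homogeneousCoords_eq (F : MvPolynomial (Fin 3) K) :
    ∃ a b : K[X], ∀ P : W.Point, P ≠ 0 → MvPolynomial.eval P.homogeneousCoords F =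
      a.eval (xCoord P) + b.eval (xCoord P) * hCoord P := by
  induction F using MvPolynomial.induction_on with
  | C c => exact ⟨C c, 0, by simp⟩
  | add F G hF hG =>
    obtain ⟨a, b, h⟩ := hF
    obtain ⟨a', b', h'⟩ := hG
    refine ⟨a + a', b + b', fun P hP ↦ ?_⟩
    rw [map_add, h P hP, h' P hP, eval_add, eval_add]
    ring
  | mul_X F i hF =>
    obtain ⟨a, b, h⟩ := hF
    fin_cases i
    · refine ⟨a * X, b * X, fun P hP ↦ ?_⟩
      rw [map_mul, h P hP, MvPolynomial.eval_X]
      obtain ⟨x, y, hxy, rfl⟩ := exists_some_of_ne_zero hP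
      simp [Point.homogeneousCoords]
      ring
    · -- Here `y = (h - a₁x - a₃) / 2`.
      refine ⟨C 2⁻¹ * (b * hSq W - a * (C W.a₁ * X + C W.a₃)),
        C 2⁻¹ * (a - b * (C W.a₁ * X + C W.a₃)), fun P hP ↦ ?_⟩
      rw [map_mul, h P hP, MvPolynomial.eval_X]
      have e := eval_hSq hP
      obtain ⟨x, y, hxy, rfl⟩ := exists_some_of_ne_zero hP
      simp only [xCoord_some, hCoord_some] at e
      simp [Point.homogeneousCoords, e]
      ring
    · refine ⟨a, b, fun P hP ↦ ?_⟩
      rw [map_mul, h P hP, MvPolynomial.eval_X]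
      obtain ⟨x, y, hxy, rfl⟩ := exists_some_of_ne_zero hP
      simp [Point.homogeneousCoords]

variable [IsAlgClosed K] [W.IsElliptic] [DecidableEq K]

/-- A morphism is rational: its coordinate functions lie in the function field `K(x, h)`, and since
`φ (-P) = -φ P`, the function `x ∘ φ` is even and `h ∘ φ` is odd under `h ↦ -h`. -/
lemma IsMorphism.isRational {φ : AddMonoid.End W.Point}
    (hφ : IsMorphism (φ : W.Point → W.Point)) : IsRational φ := by
  obtain ⟨P₀, hP₀, -⟩ := exists_xCoord_eq (W := W) 0
  obtain ⟨d, F, -, ⟨i, hi⟩, hF⟩ := hφ P₀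
  choose a b hab using fun j ↦ exists_eval_homogeneousCoords_eq (W := W) (F j)
  have hi0 : ¬(a i = 0 ∧ b i = 0) := by
    rintro ⟨h1, h2⟩
    exact hi (by rw [hab i P₀ hP₀, h1, h2]; simp)
  have hev : ∀ᶠ Q : W.Point in cofinite, ∃ c : Kˣ, ∀ j,
      (a j).eval (xCoord Q) + (b j).eval (xCoord Q) * hCoord Q = c * (φ Q).homogeneousCoords j := by
    filter_upwards [eventually_ne_zero, eventually_add_mul_hCoord_ne_zero hi0] with Q hQ h1
    obtain ⟨c, hc⟩ := hF Q ⟨i, by rwa [hab i Q hQ]⟩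
    exact ⟨c, fun j ↦ by rw [← hc, hab j Q hQ]⟩
  by_cases h2 : a 2 = 0 ∧ b 2 = 0
  · left
    refine eq_of_eventually_eq (G := W.Point) (G' := W.Point) (ψ := 0) ?_
    filter_upwards [hev] with Q hQ
    obtain ⟨c, hc⟩ := hQ
    have := hc 2
    rw [h2.1, h2.2] at this
    by_contra h0
    obtain ⟨x, y, hxy, he⟩ := exists_some_of_ne_zero h0
    rw [show φ Q = _ from he] at this
    exact c.ne_zero (by simpa [Point.homogeneousCoords] using this.symm)
  -- Numerator of `h ∘ φ`, over the denominator `a 2 + b 2 * h`.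
  set α := C 2 * a 1 + C W.a₁ * a 0 + C W.a₃ * a 2 with hα
  set β := C 2 * b 1 + C W.a₁ * b 0 + C W.a₃ * b 2 with hβ
  have hN := sq_sub_mul_hSq_ne_zero (W := W) h2
  have hev2 : ∀ᶠ Q : W.Point in cofinite, φ Q ≠ 0 ∧
      (a 0).eval (xCoord Q) + (b 0).eval (xCoord Q) * hCoord Q =
        ((a 2).eval (xCoord Q) + (b 2).eval (xCoord Q) * hCoord Q) * xCoord (φ Q) ∧
      α.eval (xCoord Q) + β.eval (xCoord Q) * hCoord Q =
        ((a 2).eval (xCoord Q) + (b 2).eval (xCoord Q) * hCoord Q) * hCoord (φ Q) := by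
    filter_upwards [hev, eventually_add_mul_hCoord_ne_zero h2] with Q hQ h3
    obtain ⟨c, hc⟩ := hQ
    have h0 := hc 0
    have h1 := hc 1
    have h2 := hc 2
    have hQ0 : φ Q ≠ 0 := by
      intro h0
      rw [h0] at h2
      exact h3 (h2.trans (mul_zero _))
    refine ⟨hQ0, ?_⟩
    obtain ⟨x, y, hxy, he⟩ := exists_some_of_ne_zero hQ0
    rw [he] at h0 h1 h2 ⊢
    simp only [Point.homogeneousCoords, Matrix.cons_val_zero, Matrix.cons_val_one,
      Matrix.cons_val, mul_one] at h0 h1 h2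
    simp only [hα, hβ, eval_add, eval_mul, eval_C, xCoord_some, hCoord_some]
    constructor
    · linear_combination h0 - x * h2
    · linear_combination W.a₁ * h0 + 2 * h1 - (2 * y + W.a₁ * x) * h2
  have hev3 := hev2.and ((neg_injective (G := W.Point)).tendsto_cofinite.eventually hev2)
  refine Or.inr ⟨hev2.mono fun Q hQ ↦ hQ.1,
    ⟨a 0 * a 2 - b 0 * b 2 * hSq W, _, hN, ?_⟩, ⟨β * a 2 - α * b 2, _, hN, ?_⟩⟩
  · filter_upwards [hev3, eventually_ne_zero] with Q hQ hQ0
    obtain ⟨⟨-, h1, -⟩, -, h2, -⟩ := hQ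
    rw [map_neg (φ : W.Point →+ W.Point), xCoord_neg, xCoord_neg, hCoord_neg] at h2
    simp only [eval_sub, eval_mul, eval_pow, eval_hSq hQ0]
    refine mul_left_cancel₀ (two_ne_zero (α := K)) ?_
    linear_combination -((a 2).eval (xCoord Q) - (b 2).eval (xCoord Q) * hCoord Q) * h1
      - ((a 2).eval (xCoord Q) + (b 2).eval (xCoord Q) * hCoord Q) * h2
  · filter_upwards [hev3, eventually_ne_zero, eventually_hCoord_ne_zero] with Q hQ hQ0 hQ1
    obtain ⟨⟨-, -, h1⟩, -, -, h2⟩ := hQ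
    rw [map_neg (φ : W.Point →+ W.Point), hCoord_neg, xCoord_neg, hCoord_neg] at h2
    simp only [eval_sub, eval_mul, eval_pow, eval_hSq hQ0]
    rw [div_mul_eq_mul_div, div_eq_iff hQ1]
    refine mul_left_cancel₀ (two_ne_zero (α := K)) ?_
    linear_combination -((a 2).eval (xCoord Q) - (b 2).eval (xCoord Q) * hCoord Q) * h1
      + ((a 2).eval (xCoord Q) + (b 2).eval (xCoord Q) * hCoord Q) * h2

end Morphism

/-! ### Automorphisms of finite order that are trivial modulo `4` -/

section Minkowski

variable {M : Type*} [AddCommGroup M]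

lemma exists_sum_pow_eq {O : AddSubgroup M} {T : AddMonoid.End M}
    (hT : ∀ x ∈ O, ∃ z ∈ O, T x = x + 4 • z) (n : ℕ) {x : M} (hx : x ∈ O) :
    ((∃ z ∈ O, (T ^ n) x = x + 4 • z)) ∧
      ∃ z ∈ O, (∑ j ∈ Finset.range n, T ^ j) x = n • x + 4 • z := by
  induction n with
  | zero => exact ⟨⟨0, O.zero_mem, by simp⟩, 0, O.zero_mem, by simp⟩
  | succ n ih =>
    obtain ⟨⟨z, hz, h⟩, w, hw, h'⟩ := ih
    constructor
    · obtain ⟨v, hv, h1⟩ := hT _ (O.add_mem hx (O.nsmul_mem hz 4))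
      refine ⟨z + v, O.add_mem hz hv, ?_⟩
      rw [pow_succ', end_mul_apply, h, h1, nsmul_add, add_assoc]
    · refine ⟨w + z, O.add_mem hw hz, ?_⟩
      rw [Finset.sum_range_succ, end_add_apply, h', h]
      module

/-- Minkowski's lemma: if an automorphism `T` of finite order is the identity modulo `4` on a group
without `2`-torsion in which only `0` is divisible by all powers of `2`, then `T` is the
identity. -/
lemma eq_of_pow_eq_of_four_dvd {O : AddSubgroup M} (htors : ∀ x : M, 2 • x = 0 → x = 0)
    (hsep : ∀ x ∈ O, (∀ k : ℕ, ∃ y, x = 2 ^ k • y) → x = 0) {n : ℕ} (hn : n ≠ 0)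
    {T : AddMonoid.End M} (hT : ∀ x ∈ O, ∃ z ∈ O, T x = x + 4 • z) {x : M} (hx : x ∈ O)
    (h : (T ^ n) x = x) : T x = x := by
  -- If `n` is odd or `n = 2`, the kernel of `1 + T + ⋯ + Tⁿ⁻¹` is `2`-divisible, hence zero.
  have key : ∀ {T : AddMonoid.End M}, (∀ x ∈ O, ∃ z ∈ O, T x = x + 4 • z) → ∀ {n : ℕ},
      (n = 2 ∨ Odd n) → ∀ {x}, x ∈ O → (T ^ n) x = x → T x = x := by
    intro T hT n hn x hx h
    have hdiv : ∀ y ∈ O, (∑ j ∈ Finset.range n, T ^ j) y = 0 →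
        ∃ z ∈ O, (∑ j ∈ Finset.range n, T ^ j) z = 0 ∧ y = 2 • z := by
      intro y hy hy0
      obtain ⟨-, z, hz, h1⟩ := exists_sum_pow_eq hT n hy
      rw [hy0] at h1
      obtain ⟨w, hw, rfl⟩ : ∃ w ∈ O, y = 2 • w := by
        rcases hn with rfl | ⟨m, rfl⟩
        · refine ⟨-z, O.neg_mem hz, ?_⟩
          rw [← sub_eq_zero]
          refine htors _ ?_
          rw [h1]
          module
        · refine ⟨-(m • y + 2 • z), O.neg_mem (O.add_mem (O.nsmul_mem hy m) (O.nsmul_mem hz 2)), ?_⟩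
          rw [← sub_eq_zero, h1]
          module
      refine ⟨w, hw, htors _ ?_, rfl⟩
      rw [← hy0]
      exact (map_nsmul (∑ j ∈ Finset.range n, T ^ j : M →+ M) 2 w).symm
    have hzero : ∀ y ∈ O, (∑ j ∈ Finset.range n, T ^ j) y = 0 → y = 0 := by
      intro y hy hy0
      refine hsep y hy fun k ↦ ?_
      suffices ∃ z ∈ O, (∑ j ∈ Finset.range n, T ^ j) z = 0 ∧ y = 2 ^ k • z from
        this.imp fun z hz ↦ hz.2.2
      induction k with
      | zero => exact ⟨y, hy, hy0, by simp⟩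
      | succ k ih =>
        obtain ⟨z, hz, hz0, rfl⟩ := ih
        obtain ⟨w, hw, hw0, rfl⟩ := hdiv z hz hz0
        exact ⟨w, hw, hw0, by rw [pow_succ, mul_nsmul']⟩
    rw [← sub_eq_zero]
    refine hzero _ ?_ ?_
    · obtain ⟨z, hz, h1⟩ := hT x hx
      rw [h1, add_sub_cancel_left]
      exact O.nsmul_mem hz 4
    · have h1 := DFunLike.congr_fun (geom_sum_mul T n) x
      rw [end_sub_apply, h] at h1
      exact h1.trans (sub_self x)
  induction n using Nat.strong_induction_on with
  | _ n ih =>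
  rcases Nat.even_or_odd' n with ⟨m, rfl | rfl⟩
  · refine ih m (by omega) (by omega) (key (n := 2) (fun x hx ↦ ?_) (Or.inl rfl) hx ?_)
    · exact (exists_sum_pow_eq hT m hx).1
    · rwa [← pow_mul, mul_comm]
  · exact key hT (Or.inr ⟨m, rfl⟩) hx h

end Minkowski

/-! ### The Galois action -/

section Galois

variable {L : Type*} [Field L] {K : Type*} [Field K] [Algebra L K] [DecidableEq K]
  (E : WeierstrassCurve L)

/-- The action of automorphisms of `K` over `L` on the group `E(K)`. -/
noncomputable def galAct : (K ≃ₐ[L] K) →* AddMonoid.End (E⁄K).Point where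
  toFun σ := Point.map (W' := E) (σ : K →ₐ[L] K)
  map_one' := AddMonoidHom.ext fun P ↦ by cases P <;> rfl
  map_mul' σ τ := AddMonoidHom.ext fun P ↦
    (Point.map_map (W' := E) (τ : K →ₐ[L] K) (σ : K →ₐ[L] K) P).symm

/-- The action of automorphisms of `K` over `L` on the endomorphisms of `E(K)` by conjugation. -/
noncomputable def galConj : (K ≃ₐ[L] K) →* AddMonoid.End (AddMonoid.End (E⁄K).Point) where
  toFun σ := AddMonoidHom.mk' (fun φ ↦ galAct E σ * φ * galAct E σ⁻¹) fun φ ψ ↦ by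
    rw [mul_add, add_mul]
  map_one' := AddMonoidHom.ext fun φ ↦ by simp; rfl
  map_mul' σ τ := AddMonoidHom.ext fun φ ↦ by simp [mul_assoc]; rfl

variable {E}

lemma galConj_apply (σ : K ≃ₐ[L] K) (φ : AddMonoid.End (E⁄K).Point) (P : (E⁄K).Point) :
    EllipticCM.galConj E σ φ P = galAct E σ (φ (galAct E σ⁻¹ P)) := rfl

lemma galConj_zero (σ : K ≃ₐ[L] K) : galConj E σ 0 = 0 :=
  map_zero (galConj E σ : AddMonoid.End (E⁄K).Point →+ AddMonoid.End (E⁄K).Point)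

lemma galConj_nsmul (σ : K ≃ₐ[L] K) (n : ℕ) (φ : AddMonoid.End (E⁄K).Point) :
    galConj E σ (n • φ) = n • galConj E σ φ :=
  map_nsmul (galConj E σ : AddMonoid.End (E⁄K).Point →+ AddMonoid.End (E⁄K).Point) n φ

lemma galAct_inv_apply (σ : K ≃ₐ[L] K) (P : (E⁄K).Point) :
    galAct E σ (galAct E σ⁻¹ P) = P := by
  rw [← end_mul_apply, ← map_mul, mul_inv_cancel, map_one, AddMonoid.End.one_apply]

lemma inv_galAct_apply (σ : K ≃ₐ[L] K) (P : (E⁄K).Point) :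
    galAct E σ⁻¹ (galAct E σ P) = P := by
  rw [← end_mul_apply, ← map_mul, inv_mul_cancel, map_one, AddMonoid.End.one_apply]

lemma galAct_injective (σ : K ≃ₐ[L] K) : Function.Injective (galAct E σ) :=
  Function.LeftInverse.injective (inv_galAct_apply σ)

lemma galAct_nsmul (σ : K ≃ₐ[L] K) (n : ℕ) (P : (E⁄K).Point) :
    galAct E σ (n • P) = n • galAct E σ P :=
  map_nsmul (galAct E σ : (E⁄K).Point →+ (E⁄K).Point) n P

lemma xCoord_galAct (σ : K ≃ₐ[L] K) (P : (E⁄K).Point) :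
    xCoord (galAct E σ P) = σ (xCoord P) := by
  rcases P with _ | ⟨x, y, h⟩
  · exact (map_zero σ).symm
  · rfl

lemma hCoord_galAct (σ : K ≃ₐ[L] K) (P : (E⁄K).Point) :
    hCoord (galAct E σ P) = σ (hCoord P) := by
  rcases P with _ | ⟨x, y, h⟩
  · exact (map_zero σ).symm
  · change 2 * σ y + algebraMap L K E.a₁ * σ x + algebraMap L K E.a₃ =
      σ (2 * y + algebraMap L K E.a₁ * x + algebraMap L K E.a₃)
    simp only [map_add, map_mul, map_ofNat, AlgEquiv.commutes]

lemma eventually_galAct_inv {p : (E⁄K).Point → Prop} (h : ∀ᶠ P in cofinite, p P)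
    (σ : K ≃ₐ[L] K) : ∀ᶠ P in cofinite, p (galAct E σ⁻¹ P) :=
  (galAct_injective σ⁻¹).tendsto_cofinite.eventually h

lemma eventually_map_eq {g : (E⁄K).Point → K} {p q : K[X]}
    (h : ∀ᶠ P in cofinite, g P * q.eval (xCoord P) = p.eval (xCoord P)) (σ : K ≃ₐ[L] K) :
    ∀ᶠ P in cofinite, σ (g (galAct E σ⁻¹ P)) * (q.map (σ : K →+* K)).eval (xCoord P) =
      (p.map (σ : K →+* K)).eval (xCoord P) := by
  filter_upwards [eventually_galAct_inv h σ] with P hP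
  have e : xCoord P = (σ : K →+* K) (xCoord (galAct E σ⁻¹ P)) := by
    rw [← galAct_inv_apply σ P, inv_galAct_apply, xCoord_galAct]
    rfl
  rw [e, eval_map_apply, eval_map_apply, ← hP, map_mul]
  rfl

lemma IsRat.galAct {g : (E⁄K).Point → K} (h : IsRat g) (σ : K ≃ₐ[L] K) :
    IsRat fun P ↦ σ (g (galAct E σ⁻¹ P)) := by
  obtain ⟨p, q, hq, h⟩ := h
  exact ⟨_, _, (Polynomial.map_ne_zero_iff (σ : K →+* K).injective).mpr hq, eventually_map_eq h σ⟩

lemma galConj_coords (σ : K ≃ₐ[L] K) (φ : AddMonoid.End (E⁄K).Point) (P : (E⁄K).Point) :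
    xCoord (EllipticCM.galConj E σ φ P) = σ (xCoord (φ (galAct E σ⁻¹ P))) ∧
    hCoord (EllipticCM.galConj E σ φ P) / hCoord P =
      σ (hCoord (φ (galAct E σ⁻¹ P)) / hCoord (galAct E σ⁻¹ P)) := by
  rw [galConj_apply, xCoord_galAct, hCoord_galAct, map_div₀, ← hCoord_galAct σ (galAct E σ⁻¹ P),
    galAct_inv_apply]
  exact ⟨rfl, rfl⟩

lemma IsRational.galConj {φ : AddMonoid.End (E⁄K).Point} (h : IsRational φ) (σ : K ≃ₐ[L] K) :
    IsRational (EllipticCM.galConj E σ φ) := by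
  rcases h with rfl | ⟨h1, h2, h3⟩
  · exact Or.inl (galConj_zero σ)
  · refine Or.inr ⟨?_, ?_, ?_⟩
    · filter_upwards [eventually_galAct_inv h1 σ] with P hP hP0
      exact hP (galAct_injective σ (hP0.trans (map_zero (galAct E σ : _ →+ _)).symm))
    · simpa only [galConj_coords] using h2.galAct σ
    · simpa only [galConj_coords] using h3.galAct σ

lemma IsAlmostRational.galConj {φ : AddMonoid.End (E⁄K).Point} (h : IsAlmostRational φ)
    (σ : K ≃ₐ[L] K) : IsAlmostRational (EllipticCM.galConj E σ φ) := by
  obtain ⟨n, hn, h⟩ := h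
  refine ⟨n, hn, ?_⟩
  have := h.galConj σ
  rwa [galConj_nsmul] at this

lemma galConj_injective (σ : K ≃ₐ[L] K) : Function.Injective (EllipticCM.galConj E σ) := by
  intro φ ψ h
  refine AddMonoidHom.ext fun P ↦ galAct_injective σ ?_
  have := DFunLike.congr_fun h (galAct E σ P)
  rwa [galConj_apply, galConj_apply, inv_galAct_apply] at this

instance [E.IsElliptic] : WeierstrassCurve.IsElliptic (E⁄K : WeierstrassCurve.Affine K) :=
  inferInstanceAs (E.map (algebraMap L K)).IsElliptic

section Algebraic

variable [Algebra.IsAlgebraic L K]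

omit [DecidableEq K] in
lemma exists_pow_apply_eq (σ : K ≃ₐ[L] K) (a : K) : ∃ n : ℕ, n ≠ 0 ∧ (σ ^ n) a = a := by
  have hfin : {b : K | aeval b (minpoly L a) = 0}.Finite := by
    have h0 := minpoly.ne_zero (Algebra.IsAlgebraic.isAlgebraic (R := L) a).isIntegral
    refine ((minpoly L a).rootSet_finite K).subset fun b hb ↦ ?_
    exact (mem_rootSet_of_ne h0).mpr hb
  obtain ⟨i, j, hij, h⟩ : ∃ i j : ℕ, i < j ∧ (σ ^ i) a = (σ ^ j) a := by
    obtain ⟨i, j, hij, h⟩ := Set.Finite.exists_lt_map_eq_of_forall_mem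
      (f := fun n : ℕ ↦ (σ ^ n) a) (t := {b : K | aeval b (minpoly L a) = 0}) (fun n ↦ by
        change aeval ((σ ^ n) a) (minpoly L a) = 0
        rw [aeval_algHom_apply, minpoly.aeval, map_zero]) hfin
    exact ⟨i, j, hij, h⟩
  refine ⟨j - i, by omega, (σ ^ i).injective ?_⟩
  rw [← AlgEquiv.mul_apply, ← pow_add, Nat.add_sub_cancel' hij.le, h]

omit [DecidableEq K] [Algebra.IsAlgebraic L K] in
lemma pow_mul_apply_eq {σ : K ≃ₐ[L] K} {a : K} {n : ℕ} (h : (σ ^ n) a = a) (m : ℕ) :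
    (σ ^ (n * m)) a = a := by
  induction m with
  | zero => simp
  | succ m ih => rw [mul_add_one, pow_add, AlgEquiv.mul_apply, h, ih]

omit [DecidableEq K] in
lemma exists_pow_forall_apply_eq (σ : K ≃ₐ[L] K) (S : Finset K) :
    ∃ n : ℕ, n ≠ 0 ∧ ∀ a ∈ S, (σ ^ n) a = a := by
  classical
  induction S using Finset.induction_on with
  | empty => exact ⟨1, one_ne_zero, by simp⟩
  | insert a S _ ih =>
    obtain ⟨n, hn, h⟩ := ih
    obtain ⟨m, hm, h'⟩ := exists_pow_apply_eq σ a
    refine ⟨m * n, mul_ne_zero hm hn, fun b hb ↦ ?_⟩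
    rcases Finset.mem_insert.mp hb with rfl | hb
    · exact pow_mul_apply_eq h' n
    · rw [mul_comm]
      exact pow_mul_apply_eq (h b hb) m

omit [DecidableEq K] [Algebra.IsAlgebraic L K] in
lemma map_eq_self_of_coeffs {σ : K ≃ₐ[L] K} {p : K[X]} (h : ∀ a ∈ p.coeffs, σ a = a) :
    p.map (σ : K →+* K) = p := by
  ext n
  rw [coeff_map]
  by_cases hn : p.coeff n = 0
  · rw [hn, map_zero]
  · exact h _ (coeff_mem_coeffs hn)

variable [IsAlgClosed K] [CharZero K] [E.IsElliptic]

/-- A rational endomorphism is defined over a finite extension of `L`. -/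
lemma IsRational.exists_galConj_pow_eq {φ : AddMonoid.End (E⁄K).Point} (h : IsRational φ)
    (σ : K ≃ₐ[L] K) : ∃ n : ℕ, n ≠ 0 ∧ EllipticCM.galConj E (σ ^ n) φ = φ := by
  classical
  by_cases h0 : φ = 0
  · exact ⟨1, one_ne_zero, by rw [h0, galConj_zero]⟩
  obtain ⟨p, q, hq, h1⟩ := h.xCoord
  obtain ⟨r, s, hs, h2⟩ := h.hCoord_div
  obtain ⟨n, hn, hfix⟩ := exists_pow_forall_apply_eq σ
    ((p.coeffs ∪ q.coeffs) ∪ (r.coeffs ∪ s.coeffs))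
  simp only [Finset.mem_union] at hfix
  refine ⟨n, hn, eq_of_eventually_eq (G := (E⁄K).Point) (G' := (E⁄K).Point) ?_⟩
  have h1' := eventually_map_eq h1 (σ ^ n)
  have h2' := eventually_map_eq h2 (σ ^ n)
  rw [map_eq_self_of_coeffs fun a ha ↦ hfix a (by tauto),
    map_eq_self_of_coeffs fun a ha ↦ hfix a (by tauto)] at h1' h2'
  have h3 : EllipticCM.galConj E (σ ^ n) φ ≠ 0 := by
    intro h3
    exact h0 (galConj_injective (σ ^ n) (h3.trans (galConj_zero _).symm))
  filter_upwards [h1, h2, h1', h2', eventually_eval_xCoord_ne_zero hq,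
    eventually_eval_xCoord_ne_zero hs, eventually_hCoord_ne_zero, h.eventually_ne_zero h0,
    (h.galConj (σ ^ n)).eventually_ne_zero h3] with P e1 e2 e1' e2' n1 n2 n3 n4 n5
  rw [← (galConj_coords (σ ^ n) φ P).1] at e1'
  rw [← (galConj_coords (σ ^ n) φ P).2] at e2'
  refine eq_of_xCoord_eq_of_hCoord_eq n5 n4 (mul_right_cancel₀ n1 (e1'.trans e1.symm)) ?_
  have := mul_right_cancel₀ n2 (e2'.trans e2.symm)
  rwa [div_left_inj' n3] at this

lemma IsAlmostRational.exists_galConj_pow_eq {φ : AddMonoid.End (E⁄K).Point}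
    (h : IsAlmostRational φ) (σ : K ≃ₐ[L] K) :
    ∃ n : ℕ, n ≠ 0 ∧ EllipticCM.galConj E (σ ^ n) φ = φ := by
  obtain ⟨m, hm, h⟩ := h
  obtain ⟨n, hn, h⟩ := h.exists_galConj_pow_eq σ
  refine ⟨n, hn, nsmul_end_injective hm ?_⟩
  rwa [galConj_nsmul] at h

/-- Automorphisms that fix the `4`-torsion commute with all almost rational endomorphisms. -/
lemma IsAlmostRational.galAct_apply_comm {φ : AddMonoid.End (E⁄K).Point}
    (h : IsAlmostRational φ) {σ : K ≃ₐ[L] K} (hσ : ∀ P, 4 • P = 0 → galAct E σ P = P)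
    (P : (E⁄K).Point) : galAct E σ (φ P) = φ (galAct E σ P) := by
  let O : AddSubgroup (AddMonoid.End (E⁄K).Point) :=
    { carrier := {ψ | IsAlmostRational ψ}
      zero_mem' := IsRational.zero.isAlmostRational
      add_mem' := IsAlmostRational.add
      neg_mem' := IsAlmostRational.neg }
  have hσ' : ∀ P, 4 • P = 0 → galAct E σ⁻¹ P = P := fun P hP ↦ by
    conv_lhs => rw [← hσ P hP, inv_galAct_apply]
  have hT : ∀ ψ ∈ O, ∃ χ ∈ O, EllipticCM.galConj E σ ψ = ψ + 4 • χ := by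
    intro ψ (hψ : IsAlmostRational ψ)
    obtain ⟨χ, hχ⟩ := exists_eq_nsmul_of_torsion (n := 4) (by norm_num)
      (φ := EllipticCM.galConj E σ ψ - ψ) fun P hP ↦ by
        rw [end_sub_apply, galConj_apply, hσ' P hP, hσ, sub_self]
        rw [← map_nsmul (ψ : _ →+ _), hP, map_zero]
    refine ⟨χ, IsAlmostRational.of_nsmul (n := 4) (by norm_num) ?_, ?_⟩
    · rw [← hχ]
      exact (hψ.galConj σ).sub hψ
    · rw [← hχ, add_sub_cancel]
  obtain ⟨n, hn, hfix⟩ := h.exists_galConj_pow_eq σ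
  have := eq_of_pow_eq_of_four_dvd (O := O) (fun ψ ↦ nsmul_end_eq_zero two_ne_zero)
    (fun ψ hψ ↦ IsAlmostRational.eq_zero_of_forall_two_pow hψ) hn hT h
    (by rwa [← map_pow])
  have := DFunLike.congr_fun this (galAct E σ P)
  rwa [galConj_apply, inv_galAct_apply] at this

end Algebraic

end Galois

/-! ### Complex multiplication acts on the `ℓ`-torsion by a non-scalar -/

section NonScalar

variable {K : Type*} [Field K] {W : WeierstrassCurve.Affine K} [IsAlgClosed K] [W.IsElliptic]
  [DecidableEq K] [CharZero K]

lemma exists_eq_intCast_add_pow_nsmul {ℓ : ℕ} (hℓ : ℓ ≠ 0)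
    (hs : ∀ ψ : AddMonoid.End W.Point, IsAlmostRational ψ →
      ∃ a : ℤ, ∀ P, ℓ • P = 0 → ψ P = a • P)
    {φ : AddMonoid.End W.Point} (hφ : IsRational φ) (k : ℕ) :
    ∃ (m : ℤ) (ψ : AddMonoid.End W.Point), IsAlmostRational ψ ∧ φ = m + (ℓ ^ k) • ψ := by
  induction k with
  | zero => exact ⟨0, φ, hφ.isAlmostRational, by simp⟩
  | succ k ih =>
    obtain ⟨m, ψ, hψ, h⟩ := ih
    obtain ⟨a, ha⟩ := hs ψ hψ
    obtain ⟨χ, hχ⟩ := exists_eq_nsmul_of_torsion hℓ (φ := ψ - (a : AddMonoid.End W.Point))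
      fun P hP ↦ by rw [end_sub_apply, ha P hP, AddMonoid.End.intCast_apply, sub_self]
    refine ⟨m + ℓ ^ k * a, χ, IsAlmostRational.of_nsmul hℓ ?_, ?_⟩
    · rw [← hχ]
      exact hψ.sub (IsRational.intCast a).isAlmostRational
    · rw [h, eq_add_of_sub_eq hχ, nsmul_add, pow_succ, mul_nsmul', Int.cast_add, Int.cast_mul,
        add_assoc, add_comm ((ℓ ^ k) • ℓ • χ), nsmul_eq_mul (ℓ ^ k) (a : AddMonoid.End W.Point)]
      push_cast
      rfl

/-- If there are `ℓ²` points of order dividing `ℓ`, then an endomorphism `φ` outside `ℤ` forces some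
almost rational endomorphism to act on them by a non-scalar. Otherwise `φ` acts on the `ℓᵏ`-torsion
as an integer `m` with `2|m| ≤ ℓᵏ`, for every `k`, and the kernel of `φ - m`, which contains the
`ℓ²ᵏ` points of order dividing `ℓᵏ`, is too large for the degree `≤ 2 deg φ + 2m²` of `φ - m`. -/
lemma exists_not_scalar {ℓ : ℕ} (hℓ : 1 < ℓ)
    (hcard : {P : W.Point | ℓ • P = 0}.ncard = ℓ ^ 2) {φ : AddMonoid.End W.Point}
    (hφ : IsRational φ) (hφ' : ∀ m : ℤ, φ ≠ m) :
    ∃ ψ : AddMonoid.End W.Point, IsAlmostRational ψ ∧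
      ¬ ∃ a : ℤ, ∀ P, ℓ • P = 0 → ψ P = a • P := by
  by_contra! hs
  have hℓ0 : ℓ ≠ 0 := by omega
  set k := 4 * deg φ with hk
  obtain ⟨m, ψ, -, h⟩ := exists_eq_intCast_add_pow_nsmul hℓ0 hs hφ k
  set m' : ℤ := m.bmod (ℓ ^ k) with hm'
  have hpos : 0 < ℓ ^ k := by positivity
  have hle : 2 * |m'| ≤ (ℓ ^ k : ℕ) := by
    have h1 := Int.le_bmod (x := m) hpos
    have h2 := Int.bmod_lt (x := m) hpos
    rw [← hm'] at h1 h2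
    rcases abs_cases m' with h3 | h3 <;> omega
  obtain ⟨c, hc⟩ : ((ℓ ^ k : ℕ) : ℤ) ∣ m - m' := Int.dvd_self_sub_bmod
  have hr : IsRational (φ - (m' : AddMonoid.End W.Point)) := hφ.sub (IsRational.intCast m')
  have h0 : φ - (m' : AddMonoid.End W.Point) ≠ 0 := sub_ne_zero.mpr (hφ' m')
  have hsub : {P : W.Point | (ℓ ^ k) • P = 0} ⊆ {P | (φ - (m' : AddMonoid.End W.Point)) P = 0} := by
    intro P (hP : (ℓ ^ k) • P = 0)
    change φ P - (m' : AddMonoid.End W.Point) P = 0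
    rw [h, end_add_apply, AddMonoid.End.intCast_apply, AddMonoid.End.intCast_apply,
      add_sub_right_comm, ← sub_smul, hc, mul_comm, mul_smul, natCast_zsmul, hP, smul_zero, zero_add]
    change (ℓ ^ k) • ψ P = 0
    rw [← map_nsmul (ψ : W.Point →+ W.Point), hP, map_zero]
  have h1 : (ℓ ^ k) ^ 2 ≤ 2 * deg φ + 2 * deg (m' : AddMonoid.End W.Point) := by
    have h2 := hφ.deg_add_add_deg_sub_le (IsRational.intCast m')
    have h3 := (ncard_torsion_pow_le (W := W) hℓ0 k).trans
      ((Set.ncard_le_ncard hsub (hr.finite_ker h0)).trans (hr.ncard_ker_le h0))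
    rw [hcard, ← pow_mul, mul_comm, pow_mul] at h3
    omega
  have h2 : k < ℓ ^ k := Nat.lt_pow_self hℓ
  have h3 := deg_intCast_le (W := W) m'
  have h4 : (2 * |m'|) ^ 2 ≤ ((ℓ ^ k : ℕ) : ℤ) ^ 2 := pow_le_pow_left₀ (by positivity) hle 2
  rw [mul_pow, sq_abs] at h4
  zify at h1 h2 hk
  push_cast at *
  nlinarith

end NonScalar

/-! ### Commutants in dimension at most two -/

section LinearAlgebra

variable {k V : Type*} [Field k] [AddCommGroup V] [Module k V]

/-- The commutant of a non-scalar endomorphism of a vector space of dimension at most `2` is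
commutative. -/
lemma commute_of_commute_of_not_scalar [FiniteDimensional k V] (hV : Module.finrank k V ≤ 2)
    {A B C : V →ₗ[k] V} (hA : ¬ ∃ a : k, A = a • 1) (hB : Commute A B) (hC : Commute A C) :
    Commute B C := by
  obtain ⟨v, hv⟩ : ∃ v, LinearIndependent k ![v, A v] := by
    by_contra! h
    exact hA (LinearMap.exists_eq_smul_id_of_forall_notLinearIndependent h)
  have hspan : ⊤ ≤ Submodule.span k (Set.range ![v, A v]) :=
    (hv.span_eq_top_of_card_eq_finrank
      (le_antisymm hv.fintype_card_le_finrank (by simpa using hV))).ge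
  -- An endomorphism commuting with `A` is determined by its value `a v + b A v` at `v`.
  have key : ∀ D : V →ₗ[k] V, Commute A D → ∃ a b : k, D = a • 1 + b • A := by
    intro D hD
    have h1 : D v ∈ Submodule.span k (Set.range ![v, A v]) := hspan Submodule.mem_top
    rw [Matrix.range_cons_cons_empty, Submodule.mem_span_pair] at h1
    obtain ⟨a, b, h1⟩ := h1
    refine ⟨a, b, LinearMap.ext_on_range (top_le_iff.mp hspan) fun i ↦ ?_⟩
    have h2 : D (A v) = A (D v) := (LinearMap.congr_fun hD.eq v).symm
    fin_cases i
    · simp [← h1]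
    · simp [h2, ← h1]
  obtain ⟨a, b, rfl⟩ := key B hB
  exact ((Commute.one_left C).smul_left a).add_left (hC.smul_left b)

lemma commute_of_finrank_le_one [FiniteDimensional k V] (hV : Module.finrank k V ≤ 1)
    (B C : V →ₗ[k] V) : Commute B C := by
  obtain ⟨v, hv⟩ := finrank_le_one_iff.mp hV
  obtain ⟨b, hb⟩ := hv (B v)
  obtain ⟨c, hc⟩ := hv (C v)
  refine LinearMap.ext fun w ↦ ?_
  obtain ⟨a, rfl⟩ := hv w
  simp [← hb, ← hc, smul_smul, mul_comm]

end LinearAlgebra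

/-! ### Criteria for solvability -/

section Solvable

variable {G H : Type*} [Group G] [Group H]

lemma isSolvable_of_card_le_three [Finite G] (h : Nat.card G ≤ 3) : Group.IsSolvable G := by
  have hpos := Nat.card_pos (α := G)
  have hc : IsCyclic G := by
    obtain h1 | h1 | h1 : Nat.card G = 1 ∨ Nat.card G = 2 ∨ Nat.card G = 3 := by omega
    · have := (Nat.card_eq_one_iff_unique.mp h1).1
      infer_instance
    · have : Fact (Nat.Prime 2) := ⟨Nat.prime_two⟩
      exact isCyclic_of_prime_card h1
    · have : Fact (Nat.Prime 3) := ⟨Nat.prime_three⟩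
      exact isCyclic_of_prime_card h1
  exact Group.isSolvable_of_comm fun a b ↦ IsCyclic.isMulCommutative.is_comm.comm a b

lemma isSolvable_perm_of_card_le_three {X : Type*} [Finite X] (h : Nat.card X ≤ 3) :
    Group.IsSolvable (Equiv.Perm X) := by
  classical
  have := Fintype.ofFinite X
  rcases subsingleton_or_nontrivial X with hX | hX
  · infer_instance
  have : Group.IsSolvable (alternatingGroup X) := by
    refine isSolvable_of_card_le_three ?_
    have h1 := two_mul_nat_card_alternatingGroup (α := X)
    have h2 : Nat.card (Equiv.Perm X) ≤ 6 := by
      rw [Nat.card_perm]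
      exact Nat.factorial_le h
    omega
  refine Group.isSolvable_of_ker_le_range (alternatingGroup X).subtype Equiv.Perm.sign ?_
  rw [Subgroup.range_subtype]
  exact le_rfl

lemma isSolvable_of_derivedSeries_le_ker {f : G →* H} (hf : Function.Surjective f) {n : ℕ}
    (h : derivedSeries G n ≤ f.ker) : Group.IsSolvable H := by
  refine ⟨n, ?_⟩
  rw [← map_derivedSeries_eq hf, Subgroup.map_eq_bot_iff]
  exact h

lemma exists_derivedSeries_le_ker [Group.IsSolvable H] (f : G →* H) :
    ∃ n, derivedSeries G n ≤ f.ker := by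
  obtain ⟨n, hn⟩ := (Group.isSolvable_def H).mp inferInstance
  refine ⟨n, ?_⟩
  rw [← Subgroup.map_eq_bot_iff, eq_bot_iff, ← hn]
  exact map_derivedSeries_le_derivedSeries f n

end Solvable

/-! ### Automorphisms that fix torsion points -/

section FixTorsion

variable {L : Type*} [Field L] {K : Type*} [Field K] [Algebra L K] [DecidableEq K]
  (E : WeierstrassCurve L)

/-- The group of automorphisms of `K` over `L` that fix all points of order dividing `n`. -/
def fixTorsion (n : ℕ) : Subgroup (K ≃ₐ[L] K) where
  carrier := {σ | ∀ P : (E⁄K).Point, n • P = 0 → galAct E σ P = P}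
  one_mem' P _ := by simp
  mul_mem' {σ τ} hσ hτ P hP := by rw [map_mul, end_mul_apply, hτ P hP, hσ P hP]
  inv_mem' {σ} hσ P hP := by conv_lhs => rw [← hσ P hP, inv_galAct_apply]

variable {E}

lemma nsmul_galAct_eq_zero {n : ℕ} (σ : K ≃ₐ[L] K) {P : (E⁄K).Point} (hP : n • P = 0) :
    n • galAct E σ P = 0 := by
  rw [← galAct_nsmul, hP, map_zero (galAct E σ : (E⁄K).Point →+ (E⁄K).Point)]

lemma commutator_mem_fixTorsion {n : ℕ} {σ τ : K ≃ₐ[L] K}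
    (h : ∀ P : (E⁄K).Point, n • P = 0 → galAct E σ (galAct E τ P) = galAct E τ (galAct E σ P)) :
    ⁅σ, τ⁆ ∈ fixTorsion E n := by
  intro P hP
  have := h _ (nsmul_galAct_eq_zero σ⁻¹ (nsmul_galAct_eq_zero τ⁻¹ hP))
  rw [galAct_inv_apply, galAct_inv_apply] at this
  rwa [commutatorElement_def, map_mul, map_mul, map_mul]

lemma commutator_fixTorsion_two_le :
    ⁅fixTorsion (K := K) E 2, fixTorsion (K := K) E 2⁆ ≤
      fixTorsion (K := K) E 4 := by
  rw [Subgroup.commutator_le]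
  intro σ hσ τ hτ
  refine commutator_mem_fixTorsion fun P hP ↦ ?_
  have hP2 : 2 • (2 • P) = 0 := by rw [← mul_nsmul, hP]
  -- An element of `fixTorsion E 2` translates `P` by a `2`-torsion point.
  have key : ∀ ρ ∈ fixTorsion (K := K) E 2, 2 • (galAct E ρ P - P) = 0 := fun ρ hρ ↦ by
    rw [smul_sub, ← galAct_nsmul, hρ _ hP2, sub_self]
  have h1 := hσ _ (key τ hτ)
  have h2 := hτ _ (key σ hσ)
  rw [map_sub (galAct E σ : (E⁄K).Point →+ (E⁄K).Point)] at h1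
  rw [map_sub (galAct E τ : (E⁄K).Point →+ (E⁄K).Point)] at h2
  rw [sub_eq_iff_eq_add] at h1 h2
  rw [h1, h2]
  abel

variable [IsAlgClosed K] [CharZero K] [E.IsElliptic]

lemma exists_derivedSeries_le_fixTorsion_two :
    ∃ n, derivedSeries (K ≃ₐ[L] K) n ≤ fixTorsion E 2 := by
  -- The action on the at most three points of order `2`.
  let X := {P : (E⁄K).Point // 2 • P = 0 ∧ P ≠ 0}
  have hfin := finite_torsion (W := (E⁄K)) two_ne_zero
  have : Finite X := (hfin.subset fun P (hP : 2 • P = 0 ∧ P ≠ 0) ↦ hP.1).to_subtype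
  have hcard : Nat.card X ≤ 3 := by
    have h1 : {P : (E⁄K).Point | 2 • P = 0 ∧ P ≠ 0} = {P : (E⁄K).Point | 2 • P = 0} \ {0} := rfl
    have h2 := ncard_torsion_le (W := (E⁄K)) two_ne_zero
    have h3 := Set.ncard_sdiff_singleton_add_one
      (show (0 : (E⁄K).Point) ∈ {P : (E⁄K).Point | 2 • P = 0} from smul_zero _) hfin
    rw [← h1] at h3
    change Nat.card {P : (E⁄K).Point | 2 • P = 0 ∧ P ≠ 0} ≤ 3
    rw [Nat.card_coe_set_eq]
    omega
  have := isSolvable_perm_of_card_le_three hcard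
  let act : MulAction (K ≃ₐ[L] K) X :=
    { smul := fun σ P ↦ ⟨galAct E σ P, nsmul_galAct_eq_zero σ P.2.1, fun h ↦ P.2.2
        (galAct_injective σ (h.trans
          (map_zero (galAct E σ : (E⁄K).Point →+ (E⁄K).Point)).symm))⟩
      one_smul := fun P ↦ Subtype.ext (by change galAct E 1 P.1 = P.1; simp)
      mul_smul := fun σ τ P ↦ Subtype.ext (by
        change galAct E (σ * τ) P.1 = galAct E σ (galAct E τ P.1)
        simp) }
  obtain ⟨n, hn⟩ := exists_derivedSeries_le_ker (MulAction.toPermHom (K ≃ₐ[L] K) X)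
  refine ⟨n, fun σ hσ P hP ↦ ?_⟩
  by_cases hP0 : P = 0
  · rw [hP0, map_zero (galAct E σ : (E⁄K).Point →+ (E⁄K).Point)]
  · exact congrArg Subtype.val (Equiv.congr_fun (MonoidHom.mem_ker.mp (hn hσ)) ⟨P, hP, hP0⟩)

/-- The restriction of an endomorphism to the `ℓ`-torsion. -/
noncomputable def torsionMap (ℓ : ℕ) (ψ : AddMonoid.End (E⁄K).Point) :
    torsion K E ℓ →ₗ[ZMod ℓ] torsion K E ℓ :=
  (AddMonoidHom.codRestrict
    (AddMonoidHom.comp (ψ : (E⁄K).Point →+ (E⁄K).Point) (torsion K E ℓ).subtype) _ fun P ↦ by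
      change ℓ • ψ P.1 = 0
      rw [← map_nsmul (ψ : (E⁄K).Point →+ (E⁄K).Point), show ℓ • P.1 = 0 from P.2,
        map_zero]).toZModLinearMap ℓ

omit [IsAlgClosed K] [CharZero K] [E.IsElliptic] in
lemma coe_torsionMap (ℓ : ℕ) (ψ : AddMonoid.End (E⁄K).Point) (P : torsion K E ℓ) :
    (torsionMap ℓ ψ P : (E⁄K).Point) = ψ P := rfl

/-- Automorphisms that fix the `4`-torsion commute with each other on the `ℓ`-torsion, since they
commute with the action of complex multiplication. -/
lemma commutator_fixTorsion_four_le [Algebra.IsAlgebraic L K] (hE : HasCM K E) {ℓ : ℕ}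
    (hℓ : ℓ.Prime) : ⁅fixTorsion (K := K) E 4, fixTorsion (K := K) E 4⁆ ≤
      fixTorsion (K := K) E ℓ := by
  have : Fact ℓ.Prime := ⟨hℓ⟩
  rw [Subgroup.commutator_le]
  intro σ hσ τ hτ
  have hfin : Finite (torsion K E ℓ) := (finite_torsion (W := (E⁄K)) hℓ.ne_zero).to_subtype
  have hfd : FiniteDimensional (ZMod ℓ) (torsion K E ℓ) := Module.Finite.of_finite
  have hncard : Nat.card (torsion K E ℓ) = {P : (E⁄K).Point | ℓ • P = 0}.ncard :=
    Nat.card_coe_set_eq {P : (E⁄K).Point | ℓ • P = 0}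
  have hcard := Module.natCard_eq_pow_finrank (K := ZMod ℓ) (V := torsion K E ℓ)
  rw [Nat.card_zmod, hncard] at hcard
  have h2 : Module.finrank (ZMod ℓ) (torsion K E ℓ) ≤ 2 := by
    have := ncard_torsion_le (W := (E⁄K)) hℓ.ne_zero
    rwa [hcard, Nat.pow_le_pow_iff_right hℓ.one_lt] at this
  suffices h : Commute (torsionMap (E := E) ℓ (galAct E σ)) (torsionMap ℓ (galAct E τ)) from
    commutator_mem_fixTorsion fun P hP ↦
      congrArg Subtype.val (LinearMap.congr_fun h.eq ⟨P, hP⟩)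
  rcases h2.lt_or_eq with h1 | h1
  · exact commute_of_finrank_le_one (by omega) _ _
  · obtain ⟨φ, hφ, hφ'⟩ := hE
    rw [h1] at hcard
    obtain ⟨ψ, hψ, hψ'⟩ := exists_not_scalar hℓ.one_lt hcard (IsMorphism.isRational hφ) hφ'
    refine commute_of_commute_of_not_scalar h2 (A := torsionMap ℓ ψ) ?_ ?_ ?_
    · rintro ⟨a, ha⟩
      refine hψ' ⟨a.val, fun P hP ↦ ?_⟩
      have := congrArg Subtype.val (LinearMap.congr_fun ha ⟨P, hP⟩)
      rw [coe_torsionMap] at this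
      rw [this, natCast_zsmul]
      conv_lhs => rw [← ZMod.natCast_zmod_val a]
      rw [LinearMap.smul_apply, Nat.cast_smul_eq_nsmul]
      rfl
    · exact LinearMap.ext fun P ↦ Subtype.ext (hψ.galAct_apply_comm hσ P.1).symm
    · exact LinearMap.ext fun P ↦ Subtype.ext (hψ.galAct_apply_comm hτ P.1).symm

lemma exists_derivedSeries_le_fixTorsion [Algebra.IsAlgebraic L K] (hE : HasCM K E) {ℓ : ℕ}
    (hℓ : ℓ.Prime) : ∃ n, derivedSeries (K ≃ₐ[L] K) n ≤ fixTorsion E ℓ := by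
  obtain ⟨n, hn⟩ := exists_derivedSeries_le_fixTorsion_two (K := K) (E := E)
  refine ⟨n + 2, ?_⟩
  have h4 : derivedSeries (K ≃ₐ[L] K) (n + 1) ≤ fixTorsion E 4 :=
    (Subgroup.commutator_mono hn hn).trans commutator_fixTorsion_two_le
  exact (Subgroup.commutator_mono h4 h4).trans (commutator_fixTorsion_four_le hE hℓ)

omit [IsAlgClosed K] [CharZero K] [E.IsElliptic] in
lemma fixTorsion_le_ker_galoisRep (ℓ : ℕ) : fixTorsion E ℓ ≤ (galoisRep K E ℓ).ker := by
  intro σ hσ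
  rw [MonoidHom.mem_ker]
  refine Units.ext (LinearMap.ext fun P ↦ Subtype.ext ?_)
  exact hσ P.1 P.2

omit [IsAlgClosed K] [CharZero K] [E.IsElliptic] in
lemma normal_divisionField [Normal L K] (ℓ : ℕ) : Normal L (divisionField K E ℓ) := by
  rw [IntermediateField.normal_iff_forall_map_le']
  intro σ
  rw [divisionField, IntermediateField.adjoin_map]
  refine IntermediateField.adjoin.mono _ _ _ ?_
  rintro _ ⟨z, ⟨x, y, h, hP, hz⟩, rfl⟩
  have hQ := nsmul_galAct_eq_zero (E := E) σ (show ℓ • Point.some x y h = 0 from hP)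
  refine ⟨σ x, σ y, _, hQ, ?_⟩
  rcases hz with rfl | rfl
  · exact Or.inl rfl
  · exact Or.inr rfl

omit [IsAlgClosed K] [CharZero K] [E.IsElliptic] in
lemma divisionField_le_fixedField (ℓ : ℕ) :
    divisionField K E ℓ ≤ IntermediateField.fixedField (fixTorsion E ℓ) := by
  rw [divisionField, IntermediateField.adjoin_le_iff]
  rintro z ⟨x, y, h, hP, hz⟩ ⟨σ, hσ⟩
  have := hσ _ hP
  have hxy : σ x = x ∧ σ y = y := by
    change Point.some (σ x) (σ y) _ = Point.some x y h at this
    exact Point.some.inj this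
  rcases hz with rfl | rfl
  · exact hxy.1
  · exact hxy.2

end FixTorsion

end EllipticCM

/-! ### Solvability of the division field -/

theorem mainTheorem3 {L : Type*} [Field L] [NumberField L]
    {Lbar : Type*} [Field Lbar] [Algebra L Lbar] [IsAlgClosure L Lbar] [DecidableEq Lbar]
    (E : WeierstrassCurve L) [E.IsElliptic] (hE : EllipticCM.HasCM Lbar E)
    (ℓ : ℕ) (hℓ : ℓ.Prime) :
    Group.IsSolvable (EllipticCM.galoisRep Lbar E ℓ).range ∧
      IsGalois L (EllipticCM.divisionField Lbar E ℓ) ∧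
      Group.IsSolvable (EllipticCM.divisionField Lbar E ℓ ≃ₐ[L] EllipticCM.divisionField Lbar E ℓ) := by
  have : IsAlgClosed Lbar := IsAlgClosure.isAlgClosed L
  have : Algebra.IsAlgebraic L Lbar := IsAlgClosure.isAlgebraic
  have : Normal L Lbar := IsAlgClosure.normal L Lbar
  have : CharZero Lbar := charZero_of_injective_algebraMap (algebraMap L Lbar).injective
  have hnormal := EllipticCM.normal_divisionField (K := Lbar) (E := E) ℓ
  obtain ⟨n, hn⟩ := EllipticCM.exists_derivedSeries_le_fixTorsion hE hℓ
  refine ⟨?_, ⟨⟩, ?_⟩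
  · refine EllipticCM.isSolvable_of_derivedSeries_le_ker
      (EllipticCM.galoisRep Lbar E ℓ).rangeRestrict_surjective (n := n) ?_
    rw [MonoidHom.ker_rangeRestrict]
    exact hn.trans (EllipticCM.fixTorsion_le_ker_galoisRep ℓ)
  · refine EllipticCM.isSolvable_of_derivedSeries_le_ker
      (AlgEquiv.restrictNormalHom_surjective (F := L) (K₁ := EllipticCM.divisionField Lbar E ℓ) Lbar)
      (n := n) ?_
    intro σ hσ
    rw [MonoidHom.mem_ker]
    refine AlgEquiv.ext fun z ↦ Subtype.ext ?_
    exact (AlgEquiv.restrictNormal_commutes σ (EllipticCM.divisionField Lbar E ℓ) z).trans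
      (EllipticCM.divisionField_le_fixedField ℓ z.2 ⟨σ, hn hσ⟩)
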